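/- Let $k$ be an algebraically closed field, let $t \geq 2$, and let $U = k[x_0,\dots,x_t]$ with its usual grading and commutative product $\circ$. Let $\varphi$ be an automorphism of $\mathbb{P}^t_k$, represented by a matrix $M \in \mathrm{GL}_{t+1}(k)$ acting on column vectors of homogeneous coordinates, and let $\phi$ be the graded automorphism $f \mapsto f \circ M$ (substitution) of $U$, so that $\mathfrak{m}_{\varphi(d)} = \phi^{-1}(\mathfrak{m}_d)$ for every point $d \in \mathbb{P}^t$, where $\mathfrak{m}_d \subseteq U$ is the homogeneous ideal of $d$. Let $S = S(\varphi)$ be the Zhang twist of $U$: the vector space $U$ with the product $fg = \phi^n(f) \circ g$ for $f \in U_m$, $g \in U_n$. For a point $c \in \mathbb{P}^t$ let $R = R(\varphi,c) = k\langle (\mathfrak{m}_c)_1 \rangle \subseteq S$ be the subalgebra of $S$ generated by the codimension-one subspace $(\mathfrak{m}_c)_1$ of $S_1 = U_1$, graded by $R_n = R \cap S_n$. Put $c_i = \varphi^{-i}(c)$ for $i \in \mathbb{Z}$, and assume the critical density condition: the set $\{c_i\}_{i\in\mathbb{Z}}$ is infinite, and every proper Zariski-closed subset of $\mathbb{P}^t$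 contains only finitely many points of it. Then $R$ is a connected $\mathbb{N}$-graded $k$-algebra (that is, $R_0 = k$), finitely generated in degree $1$, which is (left and right) noetherian but not strongly noetherian: there is a commutative noetherian $k$-algebra $B$ such that $R \otimes_k B$ is not left noetherian. -/

import Mathlib

open scoped TensorProduct LinearAlgebra.Projectivization MatrixGroups

universe u v

/-! ### Graded algebras and the noetherian conditions -/

/-- `𝒜` is an `ℕ`-grading of the `k`-algebra `A` with `A₀ = k`. -/
structure IsConnectedGraded {k : Type u} {A : Type v} [Field k] [Ring A] [Algebra k A]
    (𝒜 : ℕ → Submodule k A) : Prop where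
  graded : Nonempty (GradedAlgebra 𝒜)
  injective_algebraMap : Function.Injective (algebraMap k A)
  zero_eq : 𝒜 0 = (1 : Submodule k A)

/-- The graded algebra is finitely generated in degree one: `A₁` is finite-dimensional over `k`
and generates `A` as a `k`-algebra. -/
structure IsFinitelyGeneratedInDegreeOne {k : Type u} {A : Type v} [Field k] [Ring A] [Algebra k A]
    (𝒜 : ℕ → Submodule k A) : Prop where
  finite : Module.Finite k (𝒜 1)
  adjoin_eq_top : Algebra.adjoin k (𝒜 1 : Set A) = ⊤

/-- A ring that is both left and right noetherian (`IsNoetherianRing` is the left condition). -/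
def IsTwoSidedNoetherian (A : Type v) [Ring A] : Prop :=
  IsNoetherianRing A ∧ IsNoetherianRing Aᵐᵒᵖ

/-- A `k`-algebra `A` is strongly (left) noetherian if `A ⊗[k] B` is left noetherian for every
commutative noetherian `k`-algebra `B` (here `B` lives in the universe of `k`). -/
def IsStronglyNoetherian (k : Type u) (A : Type v) [Field k] [Ring A] [Algebra k A] : Prop :=
  ∀ (B : Type u) [CommRing B] [Algebra k B], IsNoetherianRing B → IsNoetherianRing (A ⊗[k] B)

/-! ### Points of projective space and critical density -/

section Points

variable {k : Type u} [Field k] {t : ℕ}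

/-- The homogeneous ideal `𝔪_d` of `k[x₀, …, x_t]` of the point `d` of `ℙᵗ`: the polynomials that
vanish on the line of `k^{t+1}` represented by `d`. (For `k` infinite.) -/
noncomputable def pointIdeal (d : ℙ k (Fin (t + 1) → k)) : Ideal (MvPolynomial (Fin (t + 1)) k) :=
  MvPolynomial.vanishingIdeal k (d.submodule : Set (Fin (t + 1) → k))

/-- Zariski-closed sets of points of `ℙᵗ`: the common zero loci of sets of homogeneous
polynomials. -/
def IsZariskiClosed (Y : Set (ℙ k (Fin (t + 1) → k))) : Prop :=
  ∃ T : Set (MvPolynomial (Fin (t + 1)) k),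
    (∀ f ∈ T, ∃ n, f.IsHomogeneous n) ∧ Y = {d | ∀ f ∈ T, f ∈ pointIdeal d}

/-- An infinite set of points of `ℙᵗ` is critically dense if every proper Zariski-closed subset
contains only finitely many of its points. -/
def IsCriticallyDense (C : Set (ℙ k (Fin (t + 1) → k))) : Prop :=
  C.Infinite ∧ ∀ Y : Set (ℙ k (Fin (t + 1) → k)), IsZariskiClosed Y → Y ≠ Set.univ → (Y ∩ C).Finite

end Points

/-! ### The Zhang twist -/

section Twist

open MvPolynomial

variable {k : Type u} [Field k] {t : ℕ}

/-- The graded endomorphism `f ↦ f ∘ M` of `U = k[x₀, …, x_t]`, that is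
`x_i ↦ ∑ j, M i j • x_j`. -/
noncomputable def linSubst (M : Matrix (Fin (t + 1)) (Fin (t + 1)) k) :
    MvPolynomial (Fin (t + 1)) k →ₐ[k] MvPolynomial (Fin (t + 1)) k :=
  aeval M.toMvPolynomial

theorem linSubst_one : linSubst (1 : Matrix (Fin (t + 1)) (Fin (t + 1)) k) = AlgHom.id k _ := by
  ext i : 1
  simp [linSubst, Matrix.toMvPolynomial_one]

theorem linSubst_comp (M N : Matrix (Fin (t + 1)) (Fin (t + 1)) k) :
    (linSubst M).comp (linSubst N) = linSubst (N * M) := by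
  ext i : 1
  simp only [linSubst, AlgHom.comp_apply, aeval_X, Matrix.toMvPolynomial_mul]
  rfl

/-- The graded automorphism `φ : f ↦ f ∘ M` of `U = k[x₀, …, x_t]` attached to an invertible
matrix `M`. It satisfies `φ⁻¹(𝔪_d) = 𝔪_{M • d}`, where `M` acts on column vectors of homogeneous
coordinates. -/
noncomputable def gradedAut (M : GL (Fin (t + 1)) k) :
    MvPolynomial (Fin (t + 1)) k ≃ₐ[k] MvPolynomial (Fin (t + 1)) k :=
  AlgEquiv.ofAlgHom (linSubst M.val) (linSubst M⁻¹.val)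
    (by rw [linSubst_comp, ← Units.val_mul, inv_mul_cancel, Units.val_one, linSubst_one])
    (by rw [linSubst_comp, ← Units.val_mul, mul_inv_cancel, Units.val_one, linSubst_one])

theorem gradedAut_isHomogeneous (M : GL (Fin (t + 1)) k) {f : MvPolynomial (Fin (t + 1)) k} {n : ℕ}
    (hf : f.IsHomogeneous n) : (gradedAut M f).IsHomogeneous n := by
  have h := hf.aeval M.val.toMvPolynomial (fun i => Matrix.toMvPolynomial_isHomogeneous M.val i)
  rwa [one_mul] at h

theorem gradedAut_pow_isHomogeneous (M : GL (Fin (t + 1)) k) (m : ℕ)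
    {f : MvPolynomial (Fin (t + 1)) k} {n : ℕ} (hf : f.IsHomogeneous n) :
    ((gradedAut M ^ m) f).IsHomogeneous n := by
  induction m with
  | zero => simpa using hf
  | succ m ih => rw [pow_succ', AlgEquiv.mul_apply]; exact gradedAut_isHomogeneous M ih

/-- The twisted product on the space of polynomials: `f * g = φⁿ(f) ∘ g` for `g` homogeneous of
degree `n`, where `∘` is the commutative product, extended additively in `g`. -/
noncomputable def twistMul (M : GL (Fin (t + 1)) k) (f g : MvPolynomial (Fin (t + 1)) k) :
    MvPolynomial (Fin (t + 1)) k :=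
  ∑ n ∈ Finset.range (g.totalDegree + 1), (gradedAut M ^ n) f * homogeneousComponent n g

theorem twistMul_eq (M : GL (Fin (t + 1)) k) (f g : MvPolynomial (Fin (t + 1)) k) (N : ℕ)
    (hN : g.totalDegree < N) :
    twistMul M f g = ∑ n ∈ Finset.range N, (gradedAut M ^ n) f * homogeneousComponent n g := by
  refine Finset.sum_subset (by simpa using hN) fun n _ hn => ?_
  rw [homogeneousComponent_eq_zero _ _ (by simpa using hn), mul_zero]

theorem twistMul_of_isHomogeneous (M : GL (Fin (t + 1)) k) (f : MvPolynomial (Fin (t + 1)) k)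
    {g : MvPolynomial (Fin (t + 1)) k} {n : ℕ} (hg : g.IsHomogeneous n) :
    twistMul M f g = (gradedAut M ^ n) f * g := by
  rw [twistMul_eq M f g (n + 1) (Nat.lt_succ_of_le hg.totalDegree_le), Finset.sum_eq_single n]
  · rw [homogeneousComponent_eq_self hg]
  · intro m _ hm
    rw [homogeneousComponent_of_mem (m := m) (mem_homogeneousSubmodule _ _ |>.2 hg), if_neg hm,
      mul_zero]
  · simp

theorem twistMul_add (M : GL (Fin (t + 1)) k) (f g h : MvPolynomial (Fin (t + 1)) k) :
    twistMul M f (g + h) = twistMul M f g + twistMul M f h := by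
  have hb := totalDegree_add g h
  rw [twistMul_eq M f (g + h) (max g.totalDegree h.totalDegree + 1) (by omega),
    twistMul_eq M f g (max g.totalDegree h.totalDegree + 1) (by omega),
    twistMul_eq M f h (max g.totalDegree h.totalDegree + 1) (by omega), ← Finset.sum_add_distrib]
  simp only [map_add, mul_add]

theorem add_twistMul (M : GL (Fin (t + 1)) k) (f g h : MvPolynomial (Fin (t + 1)) k) :
    twistMul M (f + g) h = twistMul M f h + twistMul M g h := by
  simp only [twistMul, map_add, add_mul, Finset.sum_add_distrib]

theorem twistMul_zero (M : GL (Fin (t + 1)) k) (f : MvPolynomial (Fin (t + 1)) k) :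
    twistMul M f 0 = 0 := by
  simp [twistMul]

theorem zero_twistMul (M : GL (Fin (t + 1)) k) (f : MvPolynomial (Fin (t + 1)) k) :
    twistMul M 0 f = 0 := by
  simp [twistMul]

theorem twistMul_C (M : GL (Fin (t + 1)) k) (f : MvPolynomial (Fin (t + 1)) k) (a : k) :
    twistMul M f (C a) = f * C a := by
  rw [twistMul_of_isHomogeneous M f (isHomogeneous_C _ a)]
  simp

theorem C_twistMul (M : GL (Fin (t + 1)) k) (f : MvPolynomial (Fin (t + 1)) k) (a : k) :
    twistMul M (C a) f = C a * f := by
  have h : ∀ n : ℕ, (gradedAut M ^ n) (C a) = C a := fun n => (gradedAut M ^ n).commutes a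
  simp only [twistMul, h, ← Finset.mul_sum, sum_homogeneousComponent]

theorem twistMul_assoc (M : GL (Fin (t + 1)) k) (f g h : MvPolynomial (Fin (t + 1)) k) :
    twistMul M (twistMul M f g) h = twistMul M f (twistMul M g h) := by
  induction h using MvPolynomial.induction_on' with
  | add p q hp hq => simp only [twistMul_add, hp, hq]
  | monomial u a =>
    have hu : (monomial u a).IsHomogeneous u.degree := isHomogeneous_monomial a rfl
    induction g using MvPolynomial.induction_on' with
    | add p q hp hq => simp only [twistMul_add, add_twistMul, hp, hq]
    | monomial w b =>
      have hw : (monomial w b).IsHomogeneous w.degree := isHomogeneous_monomial b rfl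
      rw [twistMul_of_isHomogeneous M _ hu, twistMul_of_isHomogeneous M f hw,
        twistMul_of_isHomogeneous M _ hu,
        twistMul_of_isHomogeneous M f ((gradedAut_pow_isHomogeneous M _ hw).mul hu),
        map_mul, ← AlgEquiv.mul_apply, ← pow_add, add_comm w.degree, mul_assoc]

theorem one_twistMul (M : GL (Fin (t + 1)) k) (f : MvPolynomial (Fin (t + 1)) k) :
    twistMul M 1 f = f := by
  rw [← C_1, C_twistMul, C_1, one_mul]

theorem twistMul_one (M : GL (Fin (t + 1)) k) (f : MvPolynomial (Fin (t + 1)) k) :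
    twistMul M f 1 = f := by
  rw [← C_1, twistMul_C, C_1, mul_one]

theorem smul_twistMul (M : GL (Fin (t + 1)) k) (a : k) (f g : MvPolynomial (Fin (t + 1)) k) :
    twistMul M (a • f) g = a • twistMul M f g := by
  simp only [twistMul, map_smul, smul_mul_assoc, Finset.smul_sum]

theorem twistMul_smul (M : GL (Fin (t + 1)) k) (a : k) (f g : MvPolynomial (Fin (t + 1)) k) :
    twistMul M f (a • g) = a • twistMul M f g := by
  rw [smul_eq_C_mul, smul_eq_C_mul, ← C_twistMul M g, ← twistMul_assoc, twistMul_C, mul_comm,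
    ← C_twistMul M f, twistMul_assoc, C_twistMul]

/-- The Zhang twist `S` of `U = k[x₀, …, x_t]` by `φ`: the same vector space, with the product
`f * g = φⁿ(f) ∘ g` for `g` of degree `n`. -/
def ZhangTwist (_M : GL (Fin (t + 1)) k) : Type u := MvPolynomial (Fin (t + 1)) k

namespace ZhangTwist

variable (M : GL (Fin (t + 1)) k)

noncomputable instance : AddCommGroup (ZhangTwist M) :=
  inferInstanceAs (AddCommGroup (MvPolynomial (Fin (t + 1)) k))

noncomputable instance : Module k (ZhangTwist M) :=
  inferInstanceAs (Module k (MvPolynomial (Fin (t + 1)) k))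

/-- The identification of the underlying vector spaces of `U` and `S`. -/
noncomputable def ofPoly : MvPolynomial (Fin (t + 1)) k ≃ₗ[k] ZhangTwist M :=
  LinearEquiv.refl k (MvPolynomial (Fin (t + 1)) k)

noncomputable instance : Ring (ZhangTwist M) where
  __ := (inferInstance : AddCommGroup (ZhangTwist M))
  mul f g := ofPoly M (twistMul M ((ofPoly M).symm f) ((ofPoly M).symm g))
  one := ofPoly M 1
  left_distrib f g h := twistMul_add M f g h
  right_distrib f g h := add_twistMul M f g h
  zero_mul f := zero_twistMul M f
  mul_zero f := twistMul_zero M f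
  mul_assoc f g h := twistMul_assoc M f g h
  one_mul f := one_twistMul M f
  mul_one f := twistMul_one M f

noncomputable instance : Algebra k (ZhangTwist M) :=
  Algebra.ofModule (fun a f g => smul_twistMul M a f g) (fun a f g => twistMul_smul M a f g)

/-- The degree `n` part of `S`, which is `U_n`. -/
noncomputable def degreePart (n : ℕ) : Submodule k (ZhangTwist M) :=
  (homogeneousSubmodule (Fin (t + 1)) k n).map (ofPoly M).toLinearMap

end ZhangTwist

/-! ### The algebra `R(φ, c)` -/

/-- The codimension-one subspace `V = (𝔪_c)₁` of `S₁ = U₁`, as a set of elements of `S`. -/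
def generatingSpace (M : GL (Fin (t + 1)) k) (c : ℙ k (Fin (t + 1) → k)) : Set (ZhangTwist M) :=
  ZhangTwist.ofPoly M '' {f | f.IsHomogeneous 1 ∧ f ∈ pointIdeal c}

/-- The algebra `R(φ, c) = k⟨V⟩`: the subalgebra of `S` generated by `V = (𝔪_c)₁`. -/
noncomputable def algebraR (M : GL (Fin (t + 1)) k) (c : ℙ k (Fin (t + 1) → k)) :
    Subalgebra k (ZhangTwist M) :=
  Algebra.adjoin k (generatingSpace M c)

/-- The degree `n` part `R_n = R ∩ S_n` of `R = R(φ, c)`. -/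
noncomputable def gradingR (M : GL (Fin (t + 1)) k) (c : ℙ k (Fin (t + 1) → k)) (n : ℕ) :
    Submodule k (algebraR M c) :=
  (ZhangTwist.degreePart M n).comap (algebraR M c).val.toLinearMap

end Twist

/-!
In degree `n` the algebra `R` consists of products of `n` linear forms, and the twist turns left
multiplication by `(𝔪_c)₁` in degree `n` into commutative multiplication by the space of linear
forms vanishing at `c_n`. A product of such spaces for distinct points is the space of all forms of
that degree through the points (`IsGenericSequence.mem_prod_linearFormsAt`), so `R_n` is the space
of forms of degree `n` that vanish at `c_0, …, c_{n-1}` (`mem_algebraR_iff`).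

*Noetherian.* Leading forms turn a left ideal of `R` into a sequence of spaces `L n ⊆ R_n` such that
`L (n + 1)` contains the product of `L n` with the linear forms at `c_n`; finite generation means
that equality holds for large `n`. If `f ∈ L d` is nonzero, the multiples `g f` with `g` vanishing
at `c_d, …, c_{d+m-1}` lie in `L`, and `g f ∈ L` forces `g` to vanish at all those points where `f`
does not. By critical density only finitely many of the points are zeros of `f`, so only finitely
many point conditions are involved, and each of them is eventually constant
(`IsGenericSequence.generated_of_finite_support`). The part of `L` outside the ideal of `f` is
treated by noetherian induction on ideals of `k[x]` (`IsGenericSequence.generated_modulo_ideal`):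
modulo a nonzero form the same finiteness holds for all forms, by interpolation at the points. Right
ideals reduce to the same statement for the points `c_{-1}, c_{-2}, …`.

*Not strongly noetherian.* Let `B` be the ring of those rational functions in `x` and one further
variable `τ` that have nonnegative order along each of the lines `k c_n`, where orders are extended
to `τ` as Gauss valuations. For `N` large, `f + τ^N g` has the least of the orders of `f` and `g`
along all lines at once, and by critical density a function has nonzero order along finitely many
lines; hence `B` is a principal ideal domain. The coordinates `x` define a point `y` over `B`. For
two independent linear forms `l`, `l'` at `c_N` there is a relation `α l(y) = β l'(y)` with `α`, `β`
not both in the center `𝔭_N`, so `α l - β l'`, multiplied by a form in `R_N` not vanishing at `c_N`,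
is an element of `R_{N+1} ⊗ B` that vanishes at `y`. Modulo `𝔭_N` it vanishes at `c_N` to first
order only, while the left ideal generated by elements of lower degree that vanish at `y` vanishes
at `c_N` to second order in degree `N + 1` (`tangencyIdeal`). These elements therefore generate a
left ideal of `R ⊗ B` that is not finitely generated.
-/

/-! ### Linear forms vanishing at a point -/

section LinearForms

open MvPolynomial Submodule

variable {k : Type u} [Field k] {σ : Type v}

/-- The space of linear forms of `k[x]` that vanish at the vector `p`. -/
noncomputable def linearFormsAt (p : σ → k) : Submodule k (MvPolynomial σ k) :=
  homogeneousSubmodule σ k 1 ⊓ LinearMap.ker (aeval (R := k) p).toLinearMap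

theorem mem_linearFormsAt {p : σ → k} {f : MvPolynomial σ k} :
    f ∈ linearFormsAt p ↔ f.IsHomogeneous 1 ∧ eval p f = 0 := by
  simp [linearFormsAt, aeval_eq_eval]

theorem linearFormsAt_le (p : σ → k) : linearFormsAt p ≤ homogeneousSubmodule σ k 1 :=
  inf_le_left

/-- The properties of a sequence of points of projective space, given by vectors `p i`, that the
noetherian argument uses: the points are distinct, and critically dense. -/
structure IsGenericSequence (p : ℕ → σ → k) : Prop where
  exists_linearForm : ∀ i j, i ≠ j → ∃ l ∈ linearFormsAt (p i), eval (p j) l ≠ 0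
  finite_zeros : ∀ (n : ℕ) (h : MvPolynomial σ k), h.IsHomogeneous n → h ≠ 0 →
    {i | eval (p i) h = 0}.Finite

theorem IsGenericSequence.exists_linearForm_forall_ne_zero [Infinite k] {p : ℕ → σ → k}
    (hp : IsGenericSequence p) {i : ℕ} {J : Finset ℕ} (hi : i ∉ J) :
    ∃ l ∈ linearFormsAt (p i), ∀ j ∈ J, eval (p j) l ≠ 0 := by
  obtain ⟨l, hl⟩ := Submodule.exists_forall_notMem_of_forall_ne_top
    (fun j : J => (LinearMap.ker (aeval (R := k) (p j)).toLinearMap).comap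
      (linearFormsAt (p i)).subtype) (by
      rintro ⟨j, hj⟩ htop
      obtain ⟨l, hl, hlj⟩ := hp.exists_linearForm i j (fun h => hi (h ▸ hj))
      have : (⟨l, hl⟩ : linearFormsAt (p i)) ∈ (⊤ : Submodule k _) := trivial
      rw [← htop] at this
      exact hlj (by simpa [aeval_eq_eval] using this))
  refine ⟨l, l.2, fun j hj h => hl ⟨j, hj⟩ ?_⟩
  simpa [aeval_eq_eval] using h

theorem IsGenericSequence.exists_form_ne_zero {p : ℕ → σ → k} (hp : IsGenericSequence p) (j : ℕ) :
    ∃ e : MvPolynomial σ k, e.IsHomogeneous 1 ∧ eval (p j) e ≠ 0 := by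
  obtain ⟨l, hl, hlj⟩ := hp.exists_linearForm (j + 1) j (by omega)
  exact ⟨l, (mem_linearFormsAt.1 hl).1, hlj⟩

theorem homogeneousSubmodule_succ (n : ℕ) :
    homogeneousSubmodule σ k (n + 1) = homogeneousSubmodule σ k 1 * homogeneousSubmodule σ k n := by
  rw [← homogeneousSubmodule_one_pow (σ := σ) (R := k) (n + 1), pow_succ', homogeneousSubmodule_one_pow]

theorem homogeneousSubmodule_one_le_sup {p : σ → k} {e : MvPolynomial σ k} (he : e.IsHomogeneous 1)
    (hpe : eval p e ≠ 0) : homogeneousSubmodule σ k 1 ≤ linearFormsAt p ⊔ span k {e} := by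
  intro f hf
  have : f = (f - (eval p f / eval p e) • e) + (eval p f / eval p e) • e := by ring
  rw [this]
  refine add_mem_sup (mem_linearFormsAt.2 ⟨?_, ?_⟩) (smul_mem _ _ (mem_span_singleton_self e))
  · exact (homogeneousSubmodule σ k 1).sub_mem hf (smul_mem _ _ he)
  · rw [map_sub, smul_eval, div_mul_cancel₀ _ hpe, sub_self]

/-- The homogeneous ideal of a point is generated by linear forms. -/
theorem mem_linearFormsAt_mul {p : σ → k} {e : MvPolynomial σ k} (he : e.IsHomogeneous 1)
    (hpe : eval p e ≠ 0) {n : ℕ} {f : MvPolynomial σ k} (hf : f.IsHomogeneous (n + 1))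
    (hpf : eval p f = 0) : f ∈ linearFormsAt p * homogeneousSubmodule σ k n := by
  have key : ∀ n : ℕ, homogeneousSubmodule σ k (n + 1) ≤
      linearFormsAt p * homogeneousSubmodule σ k n ⊔ span k {e ^ (n + 1)} := by
    intro n
    induction n with
    | zero =>
      have h0 : homogeneousSubmodule σ k 0 = 1 := by
        rw [← homogeneousSubmodule_one_pow, pow_zero]
      simpa [h0] using homogeneousSubmodule_one_le_sup he hpe
    | succ n ih =>
      rw [homogeneousSubmodule_succ (n + 1)]
      refine (mul_le_mul_left (homogeneousSubmodule_one_le_sup he hpe) _).trans ?_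
      rw [Submodule.sup_mul]
      refine sup_le le_sup_left ?_
      refine (mul_le_mul_right ih _).trans ?_
      rw [Submodule.mul_sup]
      refine sup_le (le_sup_of_le_left ?_) (le_sup_of_le_right ?_)
      · rw [← mul_assoc, mul_comm (span k {e}), mul_assoc]
        refine mul_le_mul_right ?_ _
        rw [homogeneousSubmodule_succ n]
        exact mul_le_mul_left (by simpa using he) _
      · rw [span_mul_span]
        simp [← pow_succ']
  obtain ⟨a, ha, b, hb, rfl⟩ := mem_sup.1 (key n hf)
  obtain ⟨c, rfl⟩ := mem_span_singleton.1 hb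
  have ha0 : eval p a = 0 := by
    have : linearFormsAt p * homogeneousSubmodule σ k n ≤
        LinearMap.ker (aeval (R := k) p).toLinearMap := by
      refine mul_le.2 fun x hx y _ => ?_
      simp [aeval_eq_eval, (mem_linearFormsAt.1 hx).2]
    simpa [aeval_eq_eval] using this ha
  rw [map_add, ha0, zero_add, smul_eval, map_pow, mul_eq_zero] at hpf
  rcases hpf with rfl | h
  · simpa using ha
  · exact absurd h (pow_ne_zero _ hpe)

/-- Modulo a linear form `h` that vanishes at none of the points `p j`, `j ∈ G`, each of the spaces
`linearFormsAt (p j)` contains all linear forms, so their product contains all forms. -/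
theorem mul_homogeneousSubmodule_card_le {p : ℕ → σ → k} {h : MvPolynomial σ k}
    (hh : h.IsHomogeneous 1) (G : Finset ℕ) (hG : ∀ j ∈ G, eval (p j) h ≠ 0)
    {A : Submodule k (MvPolynomial σ k)} (hA : A ≤ homogeneousSubmodule σ k 1) :
    A * homogeneousSubmodule σ k G.card ≤
      A * (∏ j ∈ G, linearFormsAt (p j)) ⊔ span k {h} * homogeneousSubmodule σ k G.card := by
  induction G using Finset.induction_on with
  | empty =>
    have h0 : homogeneousSubmodule σ k 0 = 1 := by
      rw [← homogeneousSubmodule_one_pow, pow_zero]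
    simp [h0]
  | insert i G hi ih =>
    rw [Finset.card_insert_of_notMem hi, Finset.prod_insert hi]
    have hAU : A * homogeneousSubmodule σ k G.card ≤ homogeneousSubmodule σ k (G.card + 1) := by
      rw [homogeneousSubmodule_succ]; exact mul_le_mul_left hA _
    have hVU : linearFormsAt (p i) * homogeneousSubmodule σ k G.card ≤
        homogeneousSubmodule σ k (G.card + 1) := by
      rw [homogeneousSubmodule_succ]; exact mul_le_mul_left (linearFormsAt_le _) _
    rw [homogeneousSubmodule_succ G.card, mul_left_comm A]
    refine (mul_le_mul_left
      (homogeneousSubmodule_one_le_sup hh (hG i (Finset.mem_insert_self i G))) _).trans ?_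
    rw [Submodule.sup_mul, ← homogeneousSubmodule_succ]
    refine sup_le ?_ (le_sup_of_le_right (mul_le_mul_right hAU _))
    refine (mul_le_mul_right (ih fun j hj => hG j (Finset.mem_insert_of_mem hj)) _).trans ?_
    rw [Submodule.mul_sup]
    refine sup_le (le_sup_of_le_left (mul_left_comm _ _ _).le) (le_sup_of_le_right ?_)
    rw [mul_left_comm]
    exact mul_le_mul_right hVU _

/-- Over distinct points, a form of degree `n` that vanishes at `n` given points is a combination
of products of linear forms through the individual points. Restricting to a hyperplane `h = 0`
through one point and no other reduces the number of points. -/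
theorem IsGenericSequence.mem_prod_linearFormsAt [Infinite k] {p : ℕ → σ → k}
    (hp : IsGenericSequence p) (J : Finset ℕ) {f : MvPolynomial σ k} (hf : f.IsHomogeneous J.card)
    (hJ : ∀ j ∈ J, eval (p j) f = 0) : f ∈ ∏ j ∈ J, linearFormsAt (p j) := by
  induction J using Finset.induction_on generalizing f with
  | empty =>
    have h0 : homogeneousSubmodule σ k 0 = 1 := by
      rw [← homogeneousSubmodule_one_pow, pow_zero]
    rw [Finset.prod_empty, ← h0]
    exact hf
  | insert i G hi ih =>
    rw [Finset.card_insert_of_notMem hi] at hf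
    rw [Finset.prod_insert hi]
    obtain ⟨h, hh, hG⟩ := hp.exists_linearForm_forall_ne_zero hi
    obtain ⟨e, he, hie⟩ := hp.exists_form_ne_zero i
    have h1 := mem_linearFormsAt_mul he hie hf (hJ i (Finset.mem_insert_self i G))
    obtain ⟨a, ha, b, hb, rfl⟩ := mem_sup.1
      (mul_homogeneousSubmodule_card_le (mem_linearFormsAt.1 hh).1 G hG (linearFormsAt_le _) h1)
    obtain ⟨g, hg, rfl⟩ := mem_span_singleton_mul.1 hb
    refine add_mem ha (mul_mem_mul hh (ih hg fun j hj => ?_))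
    have hle : linearFormsAt (p i) * ∏ j ∈ G, linearFormsAt (p j) ≤
        LinearMap.ker (aeval (R := k) (p j)).toLinearMap := by
      rw [← Finset.mul_prod_erase G _ hj, mul_left_comm]
      refine mul_le.2 fun x hx y _ => ?_
      simp [aeval_eq_eval, (mem_linearFormsAt.1 hx).2]
    have h2 : eval (p j) a = 0 := by simpa [aeval_eq_eval] using hle ha
    have h3 := hJ j (Finset.mem_insert_of_mem hj)
    rw [map_add, h2, zero_add, map_mul] at h3
    exact (mul_eq_zero.1 h3).resolve_left (hG j hj)

theorem eval_eq_zero_of_mem_prod {p : ℕ → σ → k} {J : Finset ℕ} {f : MvPolynomial σ k}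
    (hf : f ∈ ∏ j ∈ J, linearFormsAt (p j)) {j : ℕ} (hj : j ∈ J) : eval (p j) f = 0 := by
  have hle : ∏ j ∈ J, linearFormsAt (p j) ≤ LinearMap.ker (aeval (R := k) (p j)).toLinearMap := by
    rw [← Finset.mul_prod_erase J _ hj]
    refine mul_le.2 fun x hx y _ => ?_
    simp [aeval_eq_eval, (mem_linearFormsAt.1 hx).2]
  simpa [aeval_eq_eval] using hle hf

theorem isHomogeneous_of_mem_prod {p : ℕ → σ → k} {J : Finset ℕ} {f : MvPolynomial σ k}
    (hf : f ∈ ∏ j ∈ J, linearFormsAt (p j)) : f.IsHomogeneous J.card := by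
  have hle : ∏ j ∈ J, linearFormsAt (p j) ≤ homogeneousSubmodule σ k J.card := by
    rw [← homogeneousSubmodule_one_pow, ← Finset.prod_const]
    exact Finset.prod_le_prod' fun j _ => linearFormsAt_le _
  exact hle hf

theorem IsGenericSequence.mem_prod_iff [Infinite k] {p : ℕ → σ → k}
    (hp : IsGenericSequence p) {J : Finset ℕ} {f : MvPolynomial σ k} :
    f ∈ ∏ j ∈ J, linearFormsAt (p j) ↔ f.IsHomogeneous J.card ∧ ∀ j ∈ J, eval (p j) f = 0 :=
  ⟨fun h => ⟨isHomogeneous_of_mem_prod h, fun _ hj => eval_eq_zero_of_mem_prod h hj⟩,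
    fun h => hp.mem_prod_linearFormsAt J h.1 h.2⟩

/-- Forms of degree at least the number of points interpolate arbitrary values. -/
theorem IsGenericSequence.exists_interpolation {p : ℕ → σ → k}
    (hp : IsGenericSequence p) (J : Finset ℕ) {r : ℕ} (hr : J.card ≤ r) (a : ℕ → k) :
    ∃ q : MvPolynomial σ k, q.IsHomogeneous r ∧ ∀ j ∈ J, eval (p j) q = a j := by
  classical
  have sep : ∀ j ∈ J, ∃ s : MvPolynomial σ k, s.IsHomogeneous r ∧ eval (p j) s ≠ 0 ∧
      ∀ i ∈ J, i ≠ j → eval (p i) s = 0 := by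
    intro j hj
    choose! l hl hlj using fun i (hi : i ≠ j) => hp.exists_linearForm i j hi
    obtain ⟨e, he, hje⟩ := hp.exists_form_ne_zero j
    refine ⟨(∏ i ∈ J.erase j, l i) * e ^ (r - (J.erase j).card), ?_, ?_, ?_⟩
    · have h1 := IsHomogeneous.prod (J.erase j) l (fun _ => 1) fun i hi =>
        (mem_linearFormsAt.1 (hl i (Finset.ne_of_mem_erase hi))).1
      have h2 := h1.mul (he.pow (r - (J.erase j).card))
      have h3 := Finset.card_erase_le (a := j) (s := J)
      convert h2 using 1
      simp
      omega
    · rw [map_mul, map_prod, map_pow]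
      exact mul_ne_zero (Finset.prod_ne_zero_iff.2 fun i hi => hlj i (Finset.ne_of_mem_erase hi))
        (pow_ne_zero _ hje)
    · intro i hi hij
      rw [map_mul, map_prod, Finset.prod_eq_zero (Finset.mem_erase.2 ⟨hij, hi⟩), zero_mul]
      exact (mem_linearFormsAt.1 (hl i hij)).2
  choose! s hs hsj hsi using sep
  refine ⟨∑ j ∈ J, C (a j / eval (p j) (s j)) * s j, ?_, fun j hj => ?_⟩
  · exact IsHomogeneous.sum _ _ _ fun j hj => (hs j hj).C_mul _
  · rw [map_sum, Finset.sum_eq_single_of_mem j hj]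
    · rw [map_mul, eval_C, div_mul_cancel₀ _ (hsj j hj)]
    · intro i hi hij
      rw [map_mul, hsi i hi j hj hij.symm, mul_zero]

end LinearForms

/-! ### The graded noetherian property -/

section GradedNoetherian

open MvPolynomial Submodule

variable {k : Type u} [Field k] {σ : Type v}

/-- Let `K` be a graded space of forms, closed in degree `m` under multiplication by the linear
forms at `p (d + m)`, whose elements of degree `m` are constrained to vanish at all of
`p d, …, p (d + m - 1)` except those with index in a finite set `F`. The values on `F` span a
space whose dimension can only grow with the degree, so it stabilizes, and from then on `K` is
generated by its previous degree. -/
theorem IsGenericSequence.generated_of_finite_support [Infinite k] {p : ℕ → σ → k}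
    (hp : IsGenericSequence p) (d : ℕ) (F : Finset ℕ) (K : ℕ → Submodule k (MvPolynomial σ k))
    (hKU : ∀ m, K m ≤ homogeneousSubmodule σ k m)
    (hVK : ∀ m, linearFormsAt (p (d + m)) * K m ≤ K (m + 1))
    (hWK : ∀ m, ∏ j ∈ Finset.Ico d (d + m), linearFormsAt (p j) ≤ K m)
    (hF : ∀ m, ∀ g ∈ K m, ∀ j ∈ Finset.Ico d (d + m), j ∉ F → eval (p j) g = 0) :
    ∃ m₀, ∀ m ≥ m₀, K (m + 1) ≤ linearFormsAt (p (d + m)) * K m := by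
  classical
  set F' := F.filter (d ≤ ·) with hF'
  let E : MvPolynomial σ k →ₗ[k] (F' → k) :=
    LinearMap.pi fun j => (aeval (R := k) (p j)).toLinearMap
  have hE : ∀ g (j : F'), E g j = eval (p j) g := fun g j => by simp [E, aeval_eq_eval]
  obtain ⟨m₁, hm₁⟩ : ∃ m₁, ∀ j ∈ F', j < d + m₁ :=
    ⟨F'.sup id + 1, fun j hj => by have : j ≤ F'.sup id := Finset.le_sup (f := id) hj; omega⟩
  let r : ℕ → ℕ := fun m => Module.finrank k ((K m).map E)
  have key : ∀ m ≥ m₁, r m ≤ r (m + 1) ∧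
      (r (m + 1) ≤ r m → K (m + 1) ≤ linearFormsAt (p (d + m)) * K m) := by
    intro m hm
    have hni : d + m ∉ F' := fun h => by have := hm₁ _ h; omega
    obtain ⟨w, hw, hwF⟩ := hp.exists_linearForm_forall_ne_zero hni
    let D : (F' → k) →ₗ[k] (F' → k) :=
      LinearMap.pi fun j => (eval (p j) w) • LinearMap.proj j
    have hD : ∀ v j, D v j = eval (p j) w * v j := fun v j => by simp [D]
    have hDinj : Function.Injective D := by
      intro v v' h
      funext j
      have := congrFun h j
      rw [hD, hD] at this
      exact mul_left_cancel₀ (hwF j j.2) this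
    have hDE : ∀ g, D (E g) = E (w * g) := fun g => by
      funext j; rw [hD, hE, hE, map_mul]
    have hle : ((K m).map E).map D ≤ (K (m + 1)).map E := by
      rintro _ ⟨_, ⟨g, hg, rfl⟩, rfl⟩
      exact ⟨w * g, hVK m (mul_mem_mul hw hg), (hDE g).symm⟩
    have hfr : Module.finrank k (((K m).map E).map D) = r m :=
      LinearEquiv.finrank_eq (Submodule.equivMapOfInjective D hDinj _).symm
    refine ⟨hfr ▸ Submodule.finrank_mono hle, fun hr g hg => ?_⟩
    have heq : ((K m).map E).map D = (K (m + 1)).map E :=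
      Submodule.eq_of_le_of_finrank_le hle (by rw [hfr]; exact hr)
    have hgE : E g ∈ ((K m).map E).map D := heq ▸ mem_map_of_mem hg
    obtain ⟨_, ⟨g', hg', rfl⟩, hgg⟩ := hgE
    rw [hDE] at hgg
    have hmul : w * g' ∈ linearFormsAt (p (d + m)) * K m := mul_mem_mul hw hg'
    have hgK : g - w * g' ∈ K (m + 1) := sub_mem hg (hVK m hmul)
    have hW : g - w * g' ∈ ∏ j ∈ Finset.Ico d (d + (m + 1)), linearFormsAt (p j) := by
      refine hp.mem_prod_linearFormsAt _ (by simpa using hKU _ hgK) fun j hj => ?_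
      by_cases hjF : j ∈ F
      · have hj' : j ∈ F' := Finset.mem_filter.2 ⟨hjF, (Finset.mem_Ico.1 hj).1⟩
        have := congrFun hgg ⟨j, hj'⟩
        rw [hE, hE] at this
        rw [map_sub, this, sub_self]
      · exact hF _ _ hgK j hj hjF
    rw [← add_assoc, Finset.prod_Ico_succ_top (by omega), mul_comm] at hW
    rw [← sub_add_cancel g (w * g')]
    exact add_mem (mul_le_mul_right (hWK m) _ hW) hmul
  have hbdd : BddAbove (Set.range fun i => r (m₁ + i)) := by
    refine ⟨Fintype.card F', ?_⟩
    rintro _ ⟨i, rfl⟩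
    exact (Submodule.finrank_le _).trans (by simp)
  obtain ⟨i, hi⟩ := Nat.sSup_mem (Set.range_nonempty fun i => r (m₁ + i)) hbdd
  have hmono : Monotone fun i => r (m₁ + i) :=
    monotone_nat_of_le_succ fun i => (key (m₁ + i) (by omega)).1
  refine ⟨m₁ + i, fun m hm => (key m (by omega)).2 ?_⟩
  obtain ⟨j, rfl⟩ := Nat.exists_eq_add_of_le hm
  calc r (m₁ + i + j + 1) ≤ sSup (Set.range fun i => r (m₁ + i)) :=
        le_csSup hbdd ⟨i + j + 1, by simp only [add_assoc]⟩
    _ = r (m₁ + i) := hi.symm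
    _ ≤ r (m₁ + i + j) := by simpa [add_assoc] using hmono (Nat.le_add_right i j)

/-- Modulo a nonzero form `h`, every form of large degree `m` vanishes at all of
`p d, …, p (d + m - 1)` outside a fixed finite set. Besides the zeros of `h`, the finite set contains
`deg h + 1` further indices, which leaves room for interpolation in degree `m - deg h`. -/
theorem IsGenericSequence.exists_sub_mul_eval_eq_zero {p : ℕ → σ → k}
    (hp : IsGenericSequence p) (d : ℕ) {e : ℕ} {h : MvPolynomial σ k} (hh : h.IsHomogeneous e)
    (h0 : h ≠ 0) : ∃ F : Finset ℕ, ∃ m₀, ∀ m ≥ m₀, ∀ g : MvPolynomial σ k,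
      ∃ q : MvPolynomial σ k, (h * q).IsHomogeneous m ∧
        ∀ j ∈ Finset.Ico d (d + m), j ∉ F → eval (p j) (g - h * q) = 0 := by
  classical
  refine ⟨(hp.finite_zeros e h hh h0).toFinset ∪ Finset.Ico d (d + e), e, fun m hm g => ?_⟩
  obtain ⟨q, hq, hqv⟩ := hp.exists_interpolation
    ((Finset.Ico d (d + m)) \ ((hp.finite_zeros e h hh h0).toFinset ∪ Finset.Ico d (d + e)))
    (r := m - e) (by
      calc _ ≤ ((Finset.Ico d (d + m)) \ (Finset.Ico d (d + e))).card :=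
            Finset.card_le_card (Finset.sdiff_subset_sdiff le_rfl Finset.subset_union_right)
        _ = m - e := by
          rw [Finset.card_sdiff_of_subset (Finset.Ico_subset_Ico_right (by omega))]
          simp) (fun j => eval (p j) g / eval (p j) h)
  refine ⟨q, by simpa [Nat.add_sub_cancel' hm] using hh.mul hq, fun j hj hjF => ?_⟩
  have hjh : eval (p j) h ≠ 0 := fun hz => hjF (Finset.mem_union_left _ (by simpa using hz))
  rw [map_sub, map_mul, hqv j (Finset.mem_sdiff.2 ⟨hj, hjF⟩), mul_div_cancel₀ _ hjh, sub_self]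

/-- A graded space containing `h` times all forms, for some nonzero form `h`, is generated modulo
these multiples by its previous degree, in large degrees. -/
theorem IsGenericSequence.generated_of_mul_le [Infinite k] {p : ℕ → σ → k}
    (hp : IsGenericSequence p) (d : ℕ) (K N : ℕ → Submodule k (MvPolynomial σ k))
    (hKU : ∀ m, K m ≤ homogeneousSubmodule σ k m)
    (hVK : ∀ m, linearFormsAt (p (d + m)) * K m ≤ K (m + 1))
    (hWK : ∀ m, ∏ j ∈ Finset.Ico d (d + m), linearFormsAt (p j) ≤ K m)
    (hNK : ∀ m, N m ≤ K m)
    {e : ℕ} {h : MvPolynomial σ k} (hh : h.IsHomogeneous e) (h0 : h ≠ 0)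
    (hN : ∀ m q, (h * q).IsHomogeneous m → h * q ∈ N m) :
    ∃ m₀, ∀ m ≥ m₀, K (m + 1) ≤ linearFormsAt (p (d + m)) * K m ⊔ N (m + 1) := by
  obtain ⟨F, m₁, hF⟩ := hp.exists_sub_mul_eval_eq_zero d hh h0
  let X : ℕ → Submodule k (MvPolynomial σ k) := fun m =>
    ⨅ j ∈ Finset.Ico d (d + m), ⨅ _ : j ∉ F, LinearMap.ker (aeval (R := k) (p j)).toLinearMap
  have hX : ∀ m g, g ∈ X m ↔ ∀ j ∈ Finset.Ico d (d + m), j ∉ F → eval (p j) g = 0 := by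
    intro m g
    simp [X, Submodule.mem_iInf, aeval_eq_eval]
  obtain ⟨m₂, hm₂⟩ := hp.generated_of_finite_support d F (fun m => K m ⊓ X m)
    (fun m => inf_le_left.trans (hKU m))
    (fun m => by
      refine mul_le.2 fun l hl g hg => ⟨hVK m (mul_mem_mul hl hg.1), (hX _ _).2 fun j hj hjF => ?_⟩
      rw [map_mul]
      by_cases hjm : j = d + m
      · rw [hjm, (mem_linearFormsAt.1 hl).2, zero_mul]
      · rw [(hX _ _).1 hg.2 j (by simp only [Finset.mem_Ico] at hj ⊢; omega) hjF, mul_zero])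
    (fun m => le_inf (hWK m) fun g hg => (hX _ _).2 fun j hj _ => eval_eq_zero_of_mem_prod hg hj)
    (fun m g hg => (hX _ _).1 hg.2)
  refine ⟨max m₁ m₂, fun m hm g hg => ?_⟩
  obtain ⟨q, hq, hqv⟩ := hF (m + 1) (by omega) g
  have hqN := hN _ _ hq
  rw [← sub_add_cancel g (h * q)]
  refine add_mem (mem_sup_left ?_) (mem_sup_right hqN)
  have hle : linearFormsAt (p (d + m)) * (K m ⊓ X m) ≤ linearFormsAt (p (d + m)) * K m :=
    mul_le_mul_right inf_le_left _
  exact hle (hm₂ m (by omega) ⟨sub_mem hg (hNK _ hqN), (hX _ _).2 hqv⟩)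

/-- If `L` is a graded space stable under the linear forms at `p n` in degree `n`, then a form `f`
of degree `d` with `f ∈ L d` makes the space of the `g` with `g * f ∈ L` contain the products of
the linear forms at `p d, …, p (d + m - 1)`. -/
theorem prod_linearFormsAt_mul_mem {p : ℕ → σ → k} {L : ℕ → Submodule k (MvPolynomial σ k)}
    (hVL : ∀ n, linearFormsAt (p n) * L n ≤ L (n + 1)) {d : ℕ} {f : MvPolynomial σ k}
    (hf : f ∈ L d) (m : ℕ) {g : MvPolynomial σ k}
    (hg : g ∈ ∏ j ∈ Finset.Ico d (d + m), linearFormsAt (p j)) : g * f ∈ L (d + m) := by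
  have hle : (∏ j ∈ Finset.Ico d (d + m), linearFormsAt (p j)) * span k {f} ≤ L (d + m) := by
    induction m generalizing g with
    | zero => simpa using hf
    | succ m ih =>
      rw [← add_assoc, Finset.prod_Ico_succ_top (by omega), mul_comm (∏ j ∈ _, _), mul_assoc]
      by_cases h : ∃ g, g ∈ ∏ j ∈ Finset.Ico d (d + m), linearFormsAt (p j)
      · exact (mul_le_mul_right (ih h.choose_spec) _).trans (hVL _)
      · exact absurd ⟨0, zero_mem _⟩ h
  exact hle (mul_mem_mul hg (mem_span_singleton_self f))

/-- The graded space of the `g` with `g * f ∈ L`, for `f` of degree `d`. -/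
noncomputable def gradedColon (L : ℕ → Submodule k (MvPolynomial σ k)) (d : ℕ)
    (f : MvPolynomial σ k) (m : ℕ) : Submodule k (MvPolynomial σ k) :=
  homogeneousSubmodule σ k m ⊓ (L (d + m)).comap (LinearMap.mulRight k f)

theorem mem_gradedColon {L : ℕ → Submodule k (MvPolynomial σ k)} {d : ℕ} {f : MvPolynomial σ k}
    {m : ℕ} {g : MvPolynomial σ k} :
    g ∈ gradedColon L d f m ↔ g.IsHomogeneous m ∧ g * f ∈ L (d + m) := by
  simp [gradedColon]

theorem linearFormsAt_mul_gradedColon_le {p : ℕ → σ → k} {L : ℕ → Submodule k (MvPolynomial σ k)}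
    (hVL : ∀ n, linearFormsAt (p n) * L n ≤ L (n + 1)) (d : ℕ) (f : MvPolynomial σ k) (m : ℕ) :
    linearFormsAt (p (d + m)) * gradedColon L d f m ≤ gradedColon L d f (m + 1) := by
  refine mul_le.2 fun l hl g hg => ?_
  rw [mem_gradedColon] at hg ⊢
  refine ⟨by simpa [add_comm] using (mem_linearFormsAt.1 hl).1.mul hg.1, ?_⟩
  rw [mul_assoc]
  exact hVL (d + m) (mul_mem_mul hl hg.2)

theorem prod_linearFormsAt_le_gradedColon {p : ℕ → σ → k}
    {L : ℕ → Submodule k (MvPolynomial σ k)}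
    (hVL : ∀ n, linearFormsAt (p n) * L n ≤ L (n + 1)) {d : ℕ} {f : MvPolynomial σ k}
    (hf : f ∈ L d) (m : ℕ) :
    ∏ j ∈ Finset.Ico d (d + m), linearFormsAt (p j) ≤ gradedColon L d f m := fun g hg =>
  mem_gradedColon.2 ⟨by simpa using isHomogeneous_of_mem_prod hg,
    prod_linearFormsAt_mul_mem hVL hf m hg⟩

theorem mul_mem_of_mem_mul_gradedColon {p : ℕ → σ → k}
    {L : ℕ → Submodule k (MvPolynomial σ k)} {d : ℕ} {f : MvPolynomial σ k} {m : ℕ}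
    {g : MvPolynomial σ k} (hg : g ∈ linearFormsAt (p (d + m)) * gradedColon L d f m) :
    g * f ∈ linearFormsAt (p (d + m)) * L (d + m) := by
  have hle : linearFormsAt (p (d + m)) * gradedColon L d f m ≤
      (linearFormsAt (p (d + m)) * L (d + m)).comap (LinearMap.mulRight k f) := by
    refine mul_le.2 fun l hl a ha => ?_
    rw [mem_comap, LinearMap.mulRight_apply, mul_assoc]
    exact mul_mem_mul hl (mem_gradedColon.1 ha).2
  exact hle hg

theorem homogeneousComponent_mul_of_isHomogeneous {R : Type*} [CommSemiring R]
    {f : MvPolynomial σ R} {d : ℕ} (hf : f.IsHomogeneous d) (g : MvPolynomial σ R) (m : ℕ) :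
    homogeneousComponent (d + m) (g * f) = homogeneousComponent m g * f := by
  induction g using MvPolynomial.induction_on' with
  | add a b ha hb => simp only [add_mul, map_add, ha, hb]
  | monomial s a =>
    have hs : (monomial s a).IsHomogeneous s.degree := isHomogeneous_monomial a rfl
    rw [homogeneousComponent_of_mem (hs.mul hf), homogeneousComponent_of_mem hs]
    by_cases h : m = s.degree
    · rw [if_pos (by omega), if_pos h]
    · rw [if_neg (by omega), if_neg h, zero_mul]

theorem homogeneousComponent_mul_of_lt {R : Type*} [CommSemiring R]
    {f : MvPolynomial σ R} {d : ℕ} (hf : f.IsHomogeneous d) (g : MvPolynomial σ R) {n : ℕ}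
    (hn : n < d) : homogeneousComponent n (g * f) = 0 := by
  induction g using MvPolynomial.induction_on' with
  | add a b ha hb => simp only [add_mul, map_add, ha, hb, add_zero]
  | monomial s a =>
    have hs : (monomial s a).IsHomogeneous s.degree := isHomogeneous_monomial a rfl
    rw [homogeneousComponent_of_mem (hs.mul hf), if_neg (by omega)]

/-- The ideal contains the homogeneous components of its elements. -/
def IsComponentClosed (I : Ideal (MvPolynomial σ k)) : Prop :=
  ∀ x ∈ I, ∀ n, homogeneousComponent n x ∈ I

theorem IsComponentClosed.sup {I J : Ideal (MvPolynomial σ k)} (hI : IsComponentClosed I)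
    (hJ : IsComponentClosed J) : IsComponentClosed (I ⊔ J) := by
  intro x hx n
  obtain ⟨a, ha, b, hb, rfl⟩ := mem_sup.1 hx
  rw [map_add]
  exact add_mem (mem_sup_left (hI a ha n)) (mem_sup_right (hJ b hb n))

theorem isComponentClosed_span_singleton {f : MvPolynomial σ k} {d : ℕ} (hf : f.IsHomogeneous d) :
    IsComponentClosed (Ideal.span {f}) := by
  intro x hx n
  obtain ⟨g, rfl⟩ := Ideal.mem_span_singleton'.1 hx
  rcases lt_or_ge n d with h | h
  · rw [homogeneousComponent_mul_of_lt hf g h]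
    exact zero_mem _
  · obtain ⟨m, rfl⟩ := Nat.exists_eq_add_of_le h
    rw [homogeneousComponent_mul_of_isHomogeneous hf]
    exact Ideal.mul_mem_left _ _ (Ideal.mem_span_singleton_self f)

theorem exists_add_mul_of_mem_sup_span {I : Ideal (MvPolynomial σ k)}
    (hI : IsComponentClosed I) {d : ℕ} {f : MvPolynomial σ k}
    (hf : f.IsHomogeneous d) {m : ℕ} {x : MvPolynomial σ k} (hx : x ∈ I ⊔ Ideal.span {f})
    (hxn : x.IsHomogeneous (d + m)) :
    ∃ a ∈ I, a.IsHomogeneous (d + m) ∧ ∃ g : MvPolynomial σ k, g.IsHomogeneous m ∧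
      x = a + g * f := by
  obtain ⟨a, ha, b, hb, rfl⟩ := mem_sup.1 hx
  obtain ⟨g, rfl⟩ := Ideal.mem_span_singleton'.1 hb
  refine ⟨homogeneousComponent (d + m) a, hI a ha _, homogeneousComponent_isHomogeneous _ _,
    homogeneousComponent m g, homogeneousComponent_isHomogeneous _ _, ?_⟩
  rw [← homogeneousComponent_mul_of_isHomogeneous hf, ← map_add, homogeneousComponent_eq_self hxn]

/-- The sum of `L` and the graded pieces of an ideal is again stable under the linear forms. -/
theorem linearFormsAt_mul_sup_le {p : ℕ → σ → k} {L : ℕ → Submodule k (MvPolynomial σ k)} {n : ℕ}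
    (I : Ideal (MvPolynomial σ k)) :
    linearFormsAt (p n) * (L n ⊔ homogeneousSubmodule σ k n ⊓ I.restrictScalars k) ≤
      linearFormsAt (p n) * L n ⊔ homogeneousSubmodule σ k (n + 1) ⊓ I.restrictScalars k := by
  rw [Submodule.mul_sup]
  refine sup_le_sup le_rfl (mul_le.2 fun l hl g hg => ⟨?_, I.mul_mem_left l hg.2⟩)
  have := (mem_linearFormsAt.1 hl).1.mul hg.1
  rwa [add_comm] at this

/-- Graded spaces containing a nonzero homogeneous ideal `I` of `k[x]` are finitely generated
modulo `I`, by noetherian induction on `I`. -/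
theorem IsGenericSequence.generated_modulo_ideal [Infinite k] [Finite σ] {p : ℕ → σ → k}
    (hp : IsGenericSequence p) (I : Ideal (MvPolynomial σ k))
    (hI : IsComponentClosed I) (hI0 : I ≠ ⊥)
    (L : ℕ → Submodule k (MvPolynomial σ k)) (hLU : ∀ n, L n ≤ homogeneousSubmodule σ k n)
    (hVL : ∀ n, linearFormsAt (p n) * L n ≤ L (n + 1))
    (hIL : ∀ n, homogeneousSubmodule σ k n ⊓ I.restrictScalars k ≤ L n) :
    ∃ n₀, ∀ n ≥ n₀, L (n + 1) ≤ linearFormsAt (p n) * L n ⊔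
      homogeneousSubmodule σ k (n + 1) ⊓ I.restrictScalars k := by
  induction I using WellFoundedGT.induction generalizing L with
  | ind I ih =>
  by_cases hLI : ∀ n, L n ≤ I.restrictScalars k
  · exact ⟨0, fun n _ => le_sup_of_le_right (le_inf (hLU _) (hLI _))⟩
  obtain ⟨d, hd⟩ := not_forall.1 hLI
  obtain ⟨f, hfL, hfI⟩ := SetLike.not_le_iff_exists.1 hd
  have hf : f.IsHomogeneous d := hLU d hfL
  have hlt : I < I ⊔ Ideal.span {f} :=
    left_lt_sup.2 fun h => hfI (h (Ideal.mem_span_singleton_self f))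
  obtain ⟨n₁, hn₁⟩ := ih _ hlt (hI.sup (isComponentClosed_span_singleton hf))
    (ne_bot_of_gt hlt)
    (fun n => L n ⊔ homogeneousSubmodule σ k n ⊓ (I ⊔ Ideal.span {f}).restrictScalars k)
    (fun n => sup_le (hLU n) inf_le_left)
    (fun n => (linearFormsAt_mul_sup_le _).trans (sup_le_sup (hVL n) le_rfl))
    (fun n => le_sup_right)
  obtain ⟨h, e, hhI, hh, hh0⟩ : ∃ h e, h ∈ I ∧ h.IsHomogeneous e ∧ h ≠ 0 := by
    obtain ⟨x, hx, hx0⟩ := I.ne_bot_iff.1 hI0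
    by_contra! hcon
    refine hx0 ?_
    rw [← sum_homogeneousComponent x]
    exact Finset.sum_eq_zero fun n _ =>
      hcon _ n (hI x hx n) (homogeneousComponent_isHomogeneous n x)
  obtain ⟨m₀, hm₀⟩ := hp.generated_of_mul_le d (gradedColon L d f)
    (fun m => homogeneousSubmodule σ k m ⊓ I.restrictScalars k)
    (fun m => inf_le_left) (linearFormsAt_mul_gradedColon_le hVL d f)
    (prod_linearFormsAt_le_gradedColon hVL hfL)
    (fun m g hg => mem_gradedColon.2 ⟨hg.1, hIL _ ⟨by
      rw [add_comm]; exact IsHomogeneous.mul hg.1 hf, I.mul_mem_right f hg.2⟩⟩)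
    hh hh0 (fun m q hq => ⟨hq, I.mul_mem_right q hhI⟩)
  refine ⟨max n₁ (d + m₀), fun n hn x hx => ?_⟩
  obtain ⟨m, rfl⟩ := Nat.exists_eq_add_of_le (show d ≤ n by omega)
  obtain ⟨v, hv, y, hy, rfl⟩ := mem_sup.1 ((sup_le (linearFormsAt_mul_sup_le _) le_sup_right :
    _ ≤ linearFormsAt (p (d + m)) * L (d + m) ⊔ homogeneousSubmodule σ k (d + m + 1) ⊓
      (I ⊔ Ideal.span {f}).restrictScalars k) (hn₁ _ (by omega) (mem_sup_left hx)))
  refine add_mem (mem_sup_left hv) ?_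
  have hyL : y ∈ L (d + m + 1) := by
    have := sub_mem hx (hVL _ hv)
    rwa [add_sub_cancel_left] at this
  obtain ⟨a, haI, ha, g, hg, rfl⟩ := exists_add_mul_of_mem_sup_span hI hf (m := m + 1) hy.2 hy.1
  have haU : a ∈ homogeneousSubmodule σ k (d + m + 1) ⊓ I.restrictScalars k := ⟨ha, haI⟩
  have hgK : g ∈ gradedColon L d f (m + 1) := by
    refine mem_gradedColon.2 ⟨hg, ?_⟩
    have := sub_mem hyL (hIL _ haU)
    rwa [add_sub_cancel_left] at this
  obtain ⟨g₁, hg₁, g₂, hg₂, rfl⟩ := mem_sup.1 (hm₀ m (by omega) hgK)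
  refine add_mem (mem_sup_right haU) ?_
  rw [add_mul]
  refine add_mem (mem_sup_left (mul_mem_of_mem_mul_gradedColon hg₁)) (mem_sup_right ⟨?_, ?_⟩)
  · have := IsHomogeneous.mul hg₂.1 hf
    rwa [add_comm] at this
  · exact I.mul_mem_right f hg₂.2

/-- Every graded left ideal of the algebra whose degree `n` part is the product of the
`linearFormsAt (p i)`, `i < n`, is finitely generated. -/
theorem IsGenericSequence.generated [Infinite k] [Finite σ] {p : ℕ → σ → k}
    (hp : IsGenericSequence p) (L : ℕ → Submodule k (MvPolynomial σ k))
    (hLT : ∀ n, L n ≤ ∏ i ∈ Finset.range n, linearFormsAt (p i))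
    (hVL : ∀ n, linearFormsAt (p n) * L n ≤ L (n + 1)) :
    ∃ n₀, ∀ n ≥ n₀, L (n + 1) ≤ linearFormsAt (p n) * L n := by
  by_cases hL0 : ∀ n, L n ≤ ⊥
  · exact ⟨0, fun n _ => (hL0 _).trans bot_le⟩
  obtain ⟨d, hd⟩ := not_forall.1 hL0
  obtain ⟨f, hfL, hf0⟩ := SetLike.not_le_iff_exists.1 hd
  have hLU : ∀ n, L n ≤ homogeneousSubmodule σ k n := fun n x hx => by
    simpa using isHomogeneous_of_mem_prod (hLT n hx)
  have hf : f.IsHomogeneous d := hLU d hfL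
  obtain ⟨n₁, hn₁⟩ := hp.generated_modulo_ideal (Ideal.span {f})
    (isComponentClosed_span_singleton hf) (fun h => hf0 (Ideal.span_singleton_eq_bot.1 h))
    (fun n => L n ⊔ homogeneousSubmodule σ k n ⊓ (Ideal.span {f}).restrictScalars k)
    (fun n => sup_le (hLU n) inf_le_left)
    (fun n => (linearFormsAt_mul_sup_le _).trans (sup_le_sup (hVL n) le_rfl))
    (fun n => le_sup_right)
  obtain ⟨m₀, hm₀⟩ := hp.generated_of_finite_support d (hp.finite_zeros d f hf hf0).toFinset
    (gradedColon L d f) (fun m => inf_le_left) (linearFormsAt_mul_gradedColon_le hVL d f)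
    (prod_linearFormsAt_le_gradedColon hVL hfL) (fun m g hg j hj hjF => by
      have h1 := eval_eq_zero_of_mem_prod (hLT _ (mem_gradedColon.1 hg).2)
        (Finset.mem_range.2 (Finset.mem_Ico.1 hj).2)
      rw [map_mul, mul_eq_zero] at h1
      exact h1.resolve_right (by simpa using hjF))
  refine ⟨max n₁ (d + m₀), fun n hn x hx => ?_⟩
  obtain ⟨m, rfl⟩ := Nat.exists_eq_add_of_le (show d ≤ n by omega)
  obtain ⟨v, hv, y, hy, rfl⟩ := mem_sup.1 ((sup_le (linearFormsAt_mul_sup_le _) le_sup_right :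
    _ ≤ linearFormsAt (p (d + m)) * L (d + m) ⊔ homogeneousSubmodule σ k (d + m + 1) ⊓
      (Ideal.span {f}).restrictScalars k) (hn₁ _ (by omega) (mem_sup_left hx)))
  refine add_mem hv ?_
  have hyL : y ∈ L (d + m + 1) := by
    have := sub_mem hx (hVL _ hv)
    rwa [add_sub_cancel_left] at this
  obtain ⟨a, haI, ha, g, hg, rfl⟩ := exists_add_mul_of_mem_sup_span (I := ⊥)
    (fun x hx n => by rw [Ideal.mem_bot] at hx ⊢; rw [hx, map_zero]) hf (m := m + 1)
    (mem_sup_right hy.2) hy.1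
  rw [Ideal.mem_bot] at haI
  subst haI
  rw [zero_add] at hyL ⊢
  exact mul_mem_of_mem_mul_gradedColon (hm₀ m (by omega) (mem_gradedColon.2 ⟨hg, hyL⟩))

end GradedNoetherian

/-! ### The orbit of the point -/

section Orbit

open MvPolynomial Submodule

variable {k : Type u} [Field k] {t : ℕ}

theorem eval_smul_of_isHomogeneous {σ : Type v} {f : MvPolynomial σ k} {n : ℕ}
    (hf : f.IsHomogeneous n) (a : k) (w : σ → k) : eval (a • w) f = a ^ n * eval w f := by
  rw [eval_eq, eval_eq, Finset.mul_sum]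
  refine Finset.sum_congr rfl fun d hd => ?_
  have hdeg : ∑ i ∈ d.support, d i = n := (hf.degree_eq_sum_deg_support hd).symm
  simp only [Pi.smul_apply, smul_eq_mul, mul_pow, Finset.prod_mul_distrib]
  rw [Finset.prod_pow_eq_pow_sum, hdeg]
  ring

theorem mem_pointIdeal_mk_iff {w : Fin (t + 1) → k} (hw : w ≠ 0) {f : MvPolynomial (Fin (t + 1)) k}
    {n : ℕ} (hf : f.IsHomogeneous n) :
    f ∈ pointIdeal (Projectivization.mk k w hw) ↔ eval w f = 0 := by
  rw [pointIdeal, mem_vanishingIdeal_iff, Projectivization.submodule_mk]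
  constructor
  · intro h
    simpa [aeval_eq_eval] using h w (mem_span_singleton_self w)
  · intro h x hx
    obtain ⟨a, rfl⟩ := mem_span_singleton.1 hx
    simp [aeval_eq_eval, eval_smul_of_isHomogeneous hf, h]

/-- Homogeneous coordinates of the point `c_i = φ⁻ⁱ(c)`. -/
noncomputable def orbitVec (M : GL (Fin (t + 1)) k) (c : ℙ k (Fin (t + 1) → k)) (i : ℤ) :
    Fin (t + 1) → k :=
  M ^ (-i) • c.rep

theorem orbitVec_ne_zero (M : GL (Fin (t + 1)) k) (c : ℙ k (Fin (t + 1) → k)) (i : ℤ) :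
    orbitVec M c i ≠ 0 :=
  (smul_ne_zero_iff_ne _).2 c.rep_nonzero

theorem mk_orbitVec (M : GL (Fin (t + 1)) k) (c : ℙ k (Fin (t + 1) → k)) (i : ℤ) :
    Projectivization.mk k (orbitVec M c i) (orbitVec_ne_zero M c i) = M ^ (-i) • c := by
  conv_rhs => rw [← c.mk_rep]
  rfl

theorem eval_gradedAut (M : GL (Fin (t + 1)) k) (w : Fin (t + 1) → k)
    (f : MvPolynomial (Fin (t + 1)) k) : eval w (gradedAut M f) = eval (M • w) f := by
  have h : (aeval (R := k) w).comp (linSubst M.val) = aeval (R := k) (M • w) := by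
    ext i
    rw [AlgHom.comp_apply, linSubst, aeval_X, aeval_X, aeval_eq_eval,
      Matrix.toMvPolynomial_eval_eq_apply]
    rfl
  have := DFunLike.congr_fun h f
  rw [AlgHom.comp_apply, aeval_eq_eval, aeval_eq_eval] at this
  exact this

theorem eval_gradedAut_pow (M : GL (Fin (t + 1)) k) (c : ℙ k (Fin (t + 1) → k)) (n : ℕ) (i : ℤ)
    (f : MvPolynomial (Fin (t + 1)) k) :
    eval (orbitVec M c (i + n)) ((gradedAut M ^ n) f) = eval (orbitVec M c i) f := by
  induction n generalizing f with
  | zero => simp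
  | succ n ih =>
    rw [pow_succ', AlgEquiv.mul_apply, eval_gradedAut, ← ih]
    congr 2
    rw [orbitVec, orbitVec, smul_smul]
    congr 1
    rw [← zpow_one_add]
    congr 1
    push_cast
    ring

theorem eval_gradedAut_pow_symm (M : GL (Fin (t + 1)) k) (c : ℙ k (Fin (t + 1) → k)) (n : ℕ) (i : ℤ)
    (f : MvPolynomial (Fin (t + 1)) k) :
    eval (orbitVec M c i) ((gradedAut M ^ n).symm f) = eval (orbitVec M c (i + n)) f := by
  rw [← eval_gradedAut_pow M c n, AlgEquiv.apply_symm_apply]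

theorem gradedAut_pow_symm_isHomogeneous (M : GL (Fin (t + 1)) k) (m : ℕ)
    {f : MvPolynomial (Fin (t + 1)) k} {n : ℕ} (hf : f.IsHomogeneous n) :
    ((gradedAut M ^ m).symm f).IsHomogeneous n := by
  have h : ∀ f : MvPolynomial (Fin (t + 1)) k, (gradedAut M).symm f = gradedAut M⁻¹ f :=
    fun f => rfl
  induction m generalizing f with
  | zero => exact hf
  | succ m ih =>
    have : (gradedAut M ^ (m + 1)).symm f = (gradedAut M ^ m).symm ((gradedAut M).symm f) := by
      rw [AlgEquiv.symm_apply_eq, pow_succ', AlgEquiv.mul_apply, AlgEquiv.apply_symm_apply,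
        AlgEquiv.apply_symm_apply]
    rw [this, h]
    exact ih (gradedAut_isHomogeneous M⁻¹ hf)

/-- An orbit of a cyclic group with infinitely many points has no repetitions. -/
theorem zpow_smul_injective_of_infinite {G X : Type*} [Group G] [MulAction G X] (g : G) (x : X)
    (h : (Set.range fun i : ℤ => g ^ (-i) • x).Infinite) :
    Function.Injective fun i : ℤ => g ^ (-i) • x := by
  intro a b hab
  by_contra hne
  refine h ?_
  have hper : g ^ (a - b) • x = x := by
    have : g ^ (-a) • x = g ^ (-b) • x := hab
    rw [sub_eq_add_neg, zpow_add, mul_smul, ← this, smul_smul, ← zpow_add]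
    simp
  have hper' : ∀ q : ℤ, g ^ ((a - b) * q) • x = x := by
    intro q
    rw [zpow_mul]
    exact (MulAction.stabilizer G x).zpow_mem hper q
  refine (((Finset.Ico (0 : ℤ) |a - b|).finite_toSet).image fun i => g ^ i • x).subset ?_
  rintro _ ⟨i, rfl⟩
  refine ⟨(-i) % (a - b), ?_, ?_⟩
  · have h0 : a - b ≠ 0 := sub_ne_zero.2 hne
    simpa using ⟨Int.emod_nonneg _ h0, Int.emod_lt_abs _ h0⟩
  · change g ^ ((-i) % (a - b)) • x = g ^ (-i) • x
    conv_rhs => rw [← Int.emod_add_mul_ediv (-i) (a - b), zpow_add, mul_smul, hper']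

theorem exists_linearForm_of_mk_ne {w w' : Fin (t + 1) → k} (hw : w ≠ 0) (hw' : w' ≠ 0)
    (h : Projectivization.mk k w hw ≠ Projectivization.mk k w' hw') :
    ∃ l ∈ linearFormsAt w, eval w' l ≠ 0 := by
  obtain ⟨i, hi⟩ := Function.ne_iff.1 hw
  by_contra! hcon
  refine h ?_
  rw [eq_comm, Projectivization.mk_eq_mk_iff']
  refine ⟨w' i / w i, ?_⟩
  funext j
  have := hcon (C (w i) * X j - C (w j) * X i) (mem_linearFormsAt.2
    ⟨((isHomogeneous_X k j).C_mul _).sub ((isHomogeneous_X k i).C_mul _), by simp [mul_comm]⟩)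
  simp only [map_sub, map_mul, eval_C, eval_X] at this
  have hi' : w i ≠ 0 := hi
  simp only [Pi.smul_apply, smul_eq_mul]
  field_simp
  linear_combination -this

theorem isGenericSequence_orbitVec [Infinite k] {M : GL (Fin (t + 1)) k}
    {c : ℙ k (Fin (t + 1) → k)}
    (hc : IsCriticallyDense (Set.range fun i : ℤ => M ^ (-i) • c)) {s : ℕ → ℤ}
    (hs : Function.Injective s) : IsGenericSequence fun n => orbitVec M c (s n) := by
  have hinj := zpow_smul_injective_of_infinite M c hc.1
  refine ⟨fun i j hij => ?_, fun n h hh h0 => ?_⟩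
  · refine exists_linearForm_of_mk_ne (orbitVec_ne_zero _ _ _) (orbitVec_ne_zero _ _ _) ?_
    rw [mk_orbitVec, mk_orbitVec]
    exact fun h => hij (hs (hinj h))
  · have hfin := hc.2 {d | h ∈ pointIdeal d} ⟨{h}, by simpa using ⟨n, hh⟩, by simp⟩ (by
      intro huniv
      have hX : h * X 0 = 0 := by
        refine MvPolynomial.funext fun w => ?_
        by_cases hw : w = 0
        · simp [hw]
        · have : Projectivization.mk k w hw ∈ {d | h ∈ pointIdeal d} := huniv ▸ Set.mem_univ _
          rw [map_mul, (mem_pointIdeal_mk_iff hw hh).1 this, zero_mul, map_zero]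
      exact h0 ((mul_eq_zero.1 hX).resolve_right (X_ne_zero 0)))
    refine Set.Finite.subset (hfin.preimage ((hinj.comp hs).injOn)) fun i hi => ⟨?_, s i, rfl⟩
    change h ∈ pointIdeal (M ^ (-(s i)) • c)
    rw [← mk_orbitVec, mem_pointIdeal_mk_iff _ hh]
    exact hi

end Orbit

/-! ### Homogeneous components of twisted products -/

section Components

open MvPolynomial Submodule

variable {k : Type u} [Field k] {t : ℕ}

theorem homogeneousComponent_gradedAut_pow (M : GL (Fin (t + 1)) k) (m n : ℕ)
    (f : MvPolynomial (Fin (t + 1)) k) :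
    homogeneousComponent n ((gradedAut M ^ m) f) = (gradedAut M ^ m) (homogeneousComponent n f) := by
  induction f using MvPolynomial.induction_on' with
  | add a b ha hb => simp only [map_add, ha, hb]
  | monomial s a =>
    have hs : (monomial s a).IsHomogeneous s.degree := isHomogeneous_monomial a rfl
    rw [homogeneousComponent_of_mem hs,
      homogeneousComponent_of_mem (gradedAut_pow_isHomogeneous M m hs)]
    split_ifs <;> simp

theorem homogeneousComponent_twistMul (M : GL (Fin (t + 1)) k) (f g : MvPolynomial (Fin (t + 1)) k)
    (n : ℕ) : homogeneousComponent n (twistMul M f g) = ∑ b ∈ Finset.range (n + 1),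
      (gradedAut M ^ b) (homogeneousComponent (n - b) f) * homogeneousComponent b g := by
  rw [twistMul_eq M f g (max g.totalDegree n + 1) (by omega), map_sum]
  symm
  have hsub : Finset.range (n + 1) ⊆ Finset.range (max g.totalDegree n + 1) :=
    Finset.range_mono (by omega)
  rw [← Finset.sum_subset hsub]
  · refine Finset.sum_congr rfl fun b hb => ?_
    obtain ⟨a, rfl⟩ := Nat.exists_eq_add_of_le (Nat.lt_succ_iff.1 (Finset.mem_range.1 hb))
    rw [homogeneousComponent_mul_of_isHomogeneous (homogeneousComponent_isHomogeneous b g),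
      homogeneousComponent_gradedAut_pow, Nat.add_sub_cancel_left]
  · intro b _ hb
    exact homogeneousComponent_mul_of_lt (homogeneousComponent_isHomogeneous b g) _
      (by simpa [Nat.lt_succ_iff] using hb)

/-- The degree `n` component of an element of the Zhang twist, as a polynomial. -/
noncomputable def twistComponent (M : GL (Fin (t + 1)) k) (n : ℕ) :
    ZhangTwist M →ₗ[k] MvPolynomial (Fin (t + 1)) k :=
  (homogeneousComponent n).comp (ZhangTwist.ofPoly M).symm.toLinearMap

theorem twistComponent_ofPoly (M : GL (Fin (t + 1)) k) (n : ℕ) (f : MvPolynomial (Fin (t + 1)) k) :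
    twistComponent M n (ZhangTwist.ofPoly M f) = homogeneousComponent n f :=
  rfl

theorem twistComponent_isHomogeneous (M : GL (Fin (t + 1)) k) (n : ℕ) (x : ZhangTwist M) :
    (twistComponent M n x).IsHomogeneous n :=
  homogeneousComponent_isHomogeneous _ _

theorem twistComponent_mul (M : GL (Fin (t + 1)) k) (x y : ZhangTwist M) (n : ℕ) :
    twistComponent M n (x * y) = ∑ b ∈ Finset.range (n + 1),
      (gradedAut M ^ b) (twistComponent M (n - b) x) * twistComponent M b y :=
  homogeneousComponent_twistMul M _ _ n

theorem exists_forall_twistComponent_eq_zero (M : GL (Fin (t + 1)) k) (x : ZhangTwist M) :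
    ∃ N, ∀ n ≥ N, twistComponent M n x = 0 :=
  ⟨((ZhangTwist.ofPoly M).symm x).totalDegree + 1, fun n hn =>
    homogeneousComponent_eq_zero n _ (Nat.lt_of_succ_le hn)⟩

theorem sum_ofPoly_twistComponent (M : GL (Fin (t + 1)) k) (x : ZhangTwist M) {N : ℕ}
    (hN : ∀ n ≥ N, twistComponent M n x = 0) :
    ∑ n ∈ Finset.range N, ZhangTwist.ofPoly M (twistComponent M n x) = x := by
  have key : ∀ f : MvPolynomial (Fin (t + 1)) k, (∀ n ≥ N, homogeneousComponent n f = 0) →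
      ∑ n ∈ Finset.range N, homogeneousComponent n f = f := by
    intro f hf
    conv_rhs => rw [← sum_homogeneousComponent f]
    rcases le_total N (f.totalDegree + 1) with h | h
    · exact Finset.sum_subset (Finset.range_mono h) fun n _ hn => hf n (by simpa using hn)
    · exact (Finset.sum_subset (Finset.range_mono h) fun n _ hn =>
        homogeneousComponent_eq_zero n f (by simpa using hn)).symm
  rw [← map_sum]
  exact (ZhangTwist.ofPoly M).symm_apply_eq.1 (key _ hN).symm |>.symm

theorem eq_zero_of_twistComponent (M : GL (Fin (t + 1)) k) {x : ZhangTwist M}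
    (h : ∀ n, twistComponent M n x = 0) : x = 0 := by
  rw [← sum_ofPoly_twistComponent M x (N := 0) fun n _ => h n, Finset.range_zero, Finset.sum_empty]

theorem ofPoly_mul (M : GL (Fin (t + 1)) k) (f : MvPolynomial (Fin (t + 1)) k)
    {g : MvPolynomial (Fin (t + 1)) k} {n : ℕ} (hg : g.IsHomogeneous n) :
    ZhangTwist.ofPoly M f * ZhangTwist.ofPoly M g =
      ZhangTwist.ofPoly M ((gradedAut M ^ n) f * g) :=
  congrArg (ZhangTwist.ofPoly M) (twistMul_of_isHomogeneous M f hg)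

theorem algebraMap_zhangTwist (M : GL (Fin (t + 1)) k) (a : k) :
    algebraMap k (ZhangTwist M) a = ZhangTwist.ofPoly M (C a) := by
  rw [Algebra.algebraMap_eq_smul_one]
  change ZhangTwist.ofPoly M (a • 1) = _
  rw [smul_eq_C_mul, mul_one]

/-- The forms of degree `n` in `R(φ, c)`: those vanishing at `c_0, …, c_{n-1}`. -/
noncomputable def partR (M : GL (Fin (t + 1)) k) (c : ℙ k (Fin (t + 1) → k)) (n : ℕ) :
    Submodule k (MvPolynomial (Fin (t + 1)) k) :=
  ∏ i ∈ Finset.range n, linearFormsAt (orbitVec M c i)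

variable {M : GL (Fin (t + 1)) k} {c : ℙ k (Fin (t + 1) → k)}

theorem mem_partR [Infinite k] (hc : IsCriticallyDense (Set.range fun i : ℤ => M ^ (-i) • c)) {n : ℕ}
    {f : MvPolynomial (Fin (t + 1)) k} :
    f ∈ partR M c n ↔ f.IsHomogeneous n ∧ ∀ i < n, eval (orbitVec M c i) f = 0 := by
  have := (isGenericSequence_orbitVec hc (s := fun n : ℕ => (n : ℤ)) Nat.cast_injective).mem_prod_iff
    (J := Finset.range n) (f := f)
  simpa [partR] using this

theorem gradedAut_pow_mul_mem_partR [Infinite k]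
    (hc : IsCriticallyDense (Set.range fun i : ℤ => M ^ (-i) • c)) {m n : ℕ}
    {f g : MvPolynomial (Fin (t + 1)) k} (hf : f ∈ partR M c m) (hg : g ∈ partR M c n) :
    (gradedAut M ^ n) f * g ∈ partR M c (m + n) := by
  rw [mem_partR hc] at hf hg ⊢
  refine ⟨(gradedAut_pow_isHomogeneous M n hf.1).mul hg.1, fun i hi => ?_⟩
  rw [map_mul]
  rcases lt_or_ge i n with h | h
  · rw [hg.2 i h, mul_zero]
  · obtain ⟨j, rfl⟩ := Nat.exists_eq_add_of_le' h
    rw [Nat.cast_add, eval_gradedAut_pow, hf.2 j (by omega), zero_mul]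

theorem mem_generatingSpace {x : ZhangTwist M} :
    x ∈ generatingSpace M c ↔ ∃ f ∈ linearFormsAt (orbitVec M c 0), ZhangTwist.ofPoly M f = x := by
  have h : M ^ (-(0 : ℤ)) • c = c := by simp
  refine exists_congr fun f => and_congr_left' ?_
  rw [Set.mem_ofPred_eq, mem_linearFormsAt]
  refine and_congr_right fun hf => ?_
  conv_lhs => rw [← h, ← mk_orbitVec]
  exact mem_pointIdeal_mk_iff _ hf

theorem ofPoly_mem_algebraR {n : ℕ} {f : MvPolynomial (Fin (t + 1)) k} (hf : f ∈ partR M c n) :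
    ZhangTwist.ofPoly M f ∈ algebraR M c := by
  induction n generalizing f with
  | zero =>
    simp only [partR, Finset.range_zero, Finset.prod_empty] at hf
    obtain ⟨a, rfl⟩ := Submodule.mem_one.1 hf
    have : ZhangTwist.ofPoly M (algebraMap k _ a) = algebraMap k (ZhangTwist M) a :=
      (algebraMap_zhangTwist M a).symm
    rw [this]
    exact Subalgebra.algebraMap_mem _ a
  | succ n ih =>
    rw [partR, Finset.prod_range_succ, mul_comm] at hf
    induction hf using Submodule.mul_induction_on' with
    | add x _ y _ hx hy => rw [map_add]; exact add_mem hx hy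
    | mem_mul_mem l hl g hg =>
      have hgn : g.IsHomogeneous n := by simpa using isHomogeneous_of_mem_prod hg
      have hl' := mem_linearFormsAt.1 hl
      have h := ofPoly_mul M ((gradedAut M ^ n).symm l) hgn
      rw [AlgEquiv.apply_symm_apply] at h
      rw [← h]
      refine mul_mem (Algebra.subset_adjoin (mem_generatingSpace.2 ⟨_, ?_, rfl⟩)) (ih hg)
      refine mem_linearFormsAt.2 ⟨gradedAut_pow_symm_isHomogeneous M n hl'.1, ?_⟩
      rw [eval_gradedAut_pow_symm, zero_add]
      exact hl'.2

theorem mem_algebraR_iff [Infinite k] (hc : IsCriticallyDense (Set.range fun i : ℤ => M ^ (-i) • c))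
    {x : ZhangTwist M} : x ∈ algebraR M c ↔ ∀ n, twistComponent M n x ∈ partR M c n := by
  constructor
  · intro hx
    induction hx using Algebra.adjoin_induction with
    | mem x hx =>
      obtain ⟨f, hf, rfl⟩ := mem_generatingSpace.1 hx
      intro n
      rw [twistComponent_ofPoly, homogeneousComponent_of_mem (mem_linearFormsAt.1 hf).1]
      split_ifs with h
      · simpa [h, partR] using hf
      · exact zero_mem _
    | algebraMap a =>
      intro n
      rw [algebraMap_zhangTwist, twistComponent_ofPoly,
        homogeneousComponent_of_mem (isHomogeneous_C _ a)]
      split_ifs with h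
      · simp only [h, partR, Finset.range_zero, Finset.prod_empty]
        exact Submodule.mem_one.2 ⟨a, rfl⟩
      · exact zero_mem _
    | add x y _ _ hx hy => exact fun n => by rw [map_add]; exact add_mem (hx n) (hy n)
    | mul x y _ _ hx hy =>
      intro n
      rw [twistComponent_mul]
      refine sum_mem fun b hb => ?_
      have := gradedAut_pow_mul_mem_partR hc (hx (n - b)) (hy b)
      rwa [Nat.sub_add_cancel (Nat.lt_succ_iff.1 (Finset.mem_range.1 hb))] at this
  · intro h
    obtain ⟨N, hN⟩ := exists_forall_twistComponent_eq_zero M x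
    rw [← sum_ofPoly_twistComponent M x hN]
    exact sum_mem fun n _ => ofPoly_mem_algebraR (h n)

end Components

/-! ### The noetherian property of `R` -/

section Noetherian

open MvPolynomial Submodule

variable {k : Type u} [Field k]

/-- Passage to leading forms. Let `A` be a `k`-algebra with components `comp n : A → k[x]_n` whose
values vanish at `p i` for `i < n`. If leading forms of degree `n` of elements of `A` can be
multiplied by each linear form at `p n` through a left multiplication in `A`, then `A` is left
noetherian: the leading forms of a left ideal are a graded space generated in bounded degree. -/
theorem IsGenericSequence.isNoetherianRing [Infinite k] {σ : Type v} [Finite σ] {p : ℕ → σ → k}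
    (hp : IsGenericSequence p) {A : Type*} [Ring A] [Algebra k A]
    (comp : ℕ → A →ₗ[k] MvPolynomial σ k)
    (hT : ∀ n x, comp n x ∈ ∏ i ∈ Finset.range n, linearFormsAt (p i))
    (hfin : ∀ x, ∃ N, ∀ n ≥ N, comp n x = 0) (hinj : ∀ x, (∀ n, comp n x = 0) → x = 0)
    (hmul : ∀ n, ∀ l ∈ linearFormsAt (p n), ∃ s : A, ∀ x, (∀ m > n, comp m x = 0) →
      comp (n + 1) (s * x) = l * comp n x ∧ ∀ m > n + 1, comp m (s * x) = 0) :
    IsNoetherianRing A := by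
  rw [isNoetherianRing_iff_ideal_fg]
  intro I
  let Fil : ℕ → Submodule k A := fun n =>
    I.restrictScalars k ⊓ ⨅ m, ⨅ _ : m > n, LinearMap.ker (comp m)
  have hFil : ∀ n x, x ∈ Fil n ↔ x ∈ I ∧ ∀ m > n, comp m x = 0 := by
    intro n x
    simp [Fil, Submodule.mem_iInf]
  have hmono : Monotone Fil := fun a b hab x hx =>
    (hFil _ _).2 ⟨((hFil _ _).1 hx).1, fun m hm => ((hFil _ _).1 hx).2 m (by omega)⟩
  obtain ⟨n₀, hn₀⟩ := hp.generated (fun n => (Fil n).map (comp n))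
    (fun n => by rintro _ ⟨x, -, rfl⟩; exact hT n x)
    (fun n => by
      refine mul_le.2 ?_
      rintro l hl _ ⟨x, hx, rfl⟩
      obtain ⟨s, hs⟩ := hmul n l hl
      have hx' := (hFil _ _).1 hx
      obtain ⟨h1, h2⟩ := hs x hx'.2
      exact ⟨s * x, (hFil _ _).2 ⟨I.mul_mem_left s hx'.1, h2⟩, h1⟩)
  have hfd : (Fil n₀).FG := by
    have hU : ∀ n, Module.Finite k (homogeneousSubmodule σ k n) := fun n =>
      Module.Finite.iff_fg.2 (homogeneousSubmodule_fg σ k n)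
    let E : Fil n₀ →ₗ[k] ((n : Fin (n₀ + 1)) → homogeneousSubmodule σ k n) :=
      LinearMap.pi fun n => LinearMap.codRestrict _ ((comp n).comp (Fil n₀).subtype) fun x => by
        simpa using isHomogeneous_of_mem_prod (hT n x)
    rw [← Module.Finite.iff_fg]
    refine Module.Finite.of_injective E ((injective_iff_map_eq_zero E).2 fun x hx => ?_)
    refine Subtype.ext (hinj _ fun n => ?_)
    rcases lt_or_ge n₀ n with h | h
    · exact ((hFil _ _).1 x.2).2 n h
    · have := congrFun hx ⟨n, by omega⟩
      exact congrArg Subtype.val this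
  obtain ⟨S, hS⟩ := hfd
  have hSI : ∀ x ∈ Fil n₀, x ∈ Ideal.span (S : Set A) := by
    intro x hx
    rw [← hS] at hx
    exact span_le_restrictScalars k A (S : Set A) hx
  have key : ∀ n, ∀ x ∈ Fil n, x ∈ Ideal.span (S : Set A) := by
    intro n
    induction n with
    | zero => exact fun x hx => hSI x (hmono (Nat.zero_le _) hx)
    | succ n ih =>
      intro x hx
      rcases lt_or_ge n n₀ with h | h
      · exact hSI x (hmono h hx)
      have hlift : ∀ y ∈ linearFormsAt (p n) * (Fil n).map (comp n),
          ∃ z ∈ Fil (n + 1), z ∈ Ideal.span (S : Set A) ∧ comp (n + 1) z = y := by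
        intro y hy
        induction hy using Submodule.mul_induction_on' with
        | mem_mul_mem l hl g hg =>
          obtain ⟨w, hw, rfl⟩ := hg
          obtain ⟨s, hs⟩ := hmul n l hl
          have hw' := (hFil _ _).1 hw
          obtain ⟨h1, h2⟩ := hs w hw'.2
          exact ⟨s * w, (hFil _ _).2 ⟨I.mul_mem_left s hw'.1, h2⟩,
            Ideal.mul_mem_left _ s (ih w hw), h1⟩
        | add y₁ _ y₂ _ h₁ h₂ =>
          obtain ⟨z₁, a₁, b₁, rfl⟩ := h₁
          obtain ⟨z₂, a₂, b₂, rfl⟩ := h₂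
          exact ⟨z₁ + z₂, add_mem a₁ a₂, add_mem b₁ b₂, map_add _ _ _⟩
      obtain ⟨z, hz, hzS, hzx⟩ := hlift _ (hn₀ n h (mem_map_of_mem hx))
      rw [← sub_add_cancel x z]
      refine add_mem (ih _ ((hFil _ _).2 ⟨((hFil _ _).1 (sub_mem hx hz)).1, fun m hm => ?_⟩)) hzS
      rcases (Nat.succ_le_of_lt hm).eq_or_lt with h' | h'
      · rw [← h', map_sub, Nat.succ_eq_add_one, hzx, sub_self]
      · exact ((hFil _ _).1 (sub_mem hx hz)).2 m h'
  refine ⟨S, le_antisymm (Ideal.span_le.2 fun x hx => ?_) fun x hx => ?_⟩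
  · exact ((hFil n₀ x).1 (hS ▸ subset_span hx)).1
  · obtain ⟨N, hN⟩ := hfin x
    exact key N x ((hFil _ _).2 ⟨hx, fun m hm => hN m hm.le⟩)

variable {t : ℕ} {M : GL (Fin (t + 1)) k} {c : ℙ k (Fin (t + 1) → k)}

theorem twistComponent_ofPoly_mul {v : MvPolynomial (Fin (t + 1)) k} (hv : v.IsHomogeneous 1)
    (x : ZhangTwist M) (n : ℕ) : twistComponent M (n + 1) (ZhangTwist.ofPoly M v * x) =
      (gradedAut M ^ n) v * twistComponent M n x := by
  rw [twistComponent_mul, Finset.sum_eq_single n]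
  · rw [Nat.add_sub_cancel_left, twistComponent_ofPoly, homogeneousComponent_eq_self hv]
  · intro b _ hb
    rw [twistComponent_ofPoly, homogeneousComponent_of_mem hv, if_neg (by omega), map_zero, zero_mul]
  · simp

theorem twistComponent_mul_ofPoly {v : MvPolynomial (Fin (t + 1)) k} (hv : v.IsHomogeneous 1)
    (x : ZhangTwist M) (n : ℕ) : twistComponent M (n + 1) (x * ZhangTwist.ofPoly M v) =
      gradedAut M (twistComponent M n x) * v := by
  rw [twistComponent_mul, Finset.sum_eq_single 1]
  · rw [twistComponent_ofPoly, homogeneousComponent_eq_self hv, pow_one, Nat.add_sub_cancel]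
  · intro b _ hb
    rw [twistComponent_ofPoly, homogeneousComponent_of_mem hv, if_neg hb, mul_zero]
  · simp

theorem isNoetherianRing_algebraR [Infinite k]
    (hc : IsCriticallyDense (Set.range fun i : ℤ => M ^ (-i) • c)) :
    IsNoetherianRing (algebraR M c) := by
  refine (isGenericSequence_orbitVec hc (s := fun n : ℕ => (n : ℤ))
    Nat.cast_injective).isNoetherianRing
    (fun n => (twistComponent M n).comp (algebraR M c).val.toLinearMap)
    (fun n x => (mem_algebraR_iff hc).1 x.2 n)
    (fun x => exists_forall_twistComponent_eq_zero M x)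
    (fun x hx => Subtype.ext (eq_zero_of_twistComponent M hx)) (fun n l hl => ?_)
  have hl' := mem_linearFormsAt.1 hl
  have hv : ((gradedAut M ^ n).symm l).IsHomogeneous 1 := gradedAut_pow_symm_isHomogeneous M n hl'.1
  refine ⟨⟨ZhangTwist.ofPoly M ((gradedAut M ^ n).symm l), Algebra.subset_adjoin
    (mem_generatingSpace.2 ⟨_, mem_linearFormsAt.2 ⟨hv, ?_⟩, rfl⟩)⟩, fun x hx => ⟨?_, fun m hm => ?_⟩⟩
  · rw [eval_gradedAut_pow_symm, zero_add]
    exact hl'.2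
  · change twistComponent M (n + 1) (_ * (x : ZhangTwist M)) = _
    rw [twistComponent_ofPoly_mul hv, AlgEquiv.apply_symm_apply]
    rfl
  · obtain ⟨m, rfl⟩ := Nat.exists_eq_add_of_le' (show 1 ≤ m by omega)
    change twistComponent M (m + 1) (_ * (x : ZhangTwist M)) = _
    have h0 : twistComponent M m (x : ZhangTwist M) = 0 := hx m (by omega)
    rw [twistComponent_ofPoly_mul hv, h0, mul_zero]

/-- For right ideals, the forms of degree `n` are moved by `φ⁻ⁿ`. This turns right multiplication
by elements of `(𝔪_c)₁` into multiplication by linear forms at the points `c_{-n-1}` of the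
backward orbit. -/
theorem isNoetherianRing_algebraR_op [Infinite k]
    (hc : IsCriticallyDense (Set.range fun i : ℤ => M ^ (-i) • c)) :
    IsNoetherianRing (algebraR M c)ᵐᵒᵖ := by
  have hgen := isGenericSequence_orbitVec hc (s := fun n : ℕ => -(n : ℤ) - 1)
    (fun a b h => by simpa using h)
  refine hgen.isNoetherianRing
    (fun n => (gradedAut M ^ n).symm.toLinearMap.comp ((twistComponent M n).comp
      ((algebraR M c).val.toLinearMap.comp (MulOpposite.opLinearEquiv k).symm.toLinearMap)))
    (fun n x => ?_) (fun x => ?_) (fun x hx => ?_) (fun n l hl => ?_)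
  · change (gradedAut M ^ n).symm (twistComponent M n (x.unop : ZhangTwist M)) ∈ _
    have hx := (mem_partR hc).1 ((mem_algebraR_iff hc).1 x.unop.2 n)
    refine hgen.mem_prod_linearFormsAt _ ?_ fun i hi => ?_
    · simpa using gradedAut_pow_symm_isHomogeneous M n hx.1
    · have hi' := Finset.mem_range.1 hi
      rw [eval_gradedAut_pow_symm]
      rw [show -(i : ℤ) - 1 + n = ((n - 1 - i : ℕ) : ℤ) by omega]
      exact hx.2 (n - 1 - i) (by omega)
  · obtain ⟨N, hN⟩ := exists_forall_twistComponent_eq_zero M (x.unop : ZhangTwist M)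
    refine ⟨N, fun n hn => ?_⟩
    change (gradedAut M ^ n).symm (twistComponent M n (x.unop : ZhangTwist M)) = 0
    rw [hN n hn, map_zero]
  · refine MulOpposite.unop_injective (Subtype.ext (eq_zero_of_twistComponent M fun n => ?_))
    exact (map_eq_zero_iff _ (gradedAut M ^ n).symm.injective).1 (hx n)
  · have hl' := mem_linearFormsAt.1 hl
    have hv : ((gradedAut M ^ (n + 1)) l).IsHomogeneous 1 :=
      gradedAut_pow_isHomogeneous M (n + 1) hl'.1
    have hcomp : ∀ (m : ℕ) (x : ZhangTwist M), (gradedAut M ^ (m + 1)).symm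
        (twistComponent M (m + 1) (x * ZhangTwist.ofPoly M ((gradedAut M ^ (n + 1)) l))) =
        (gradedAut M ^ m).symm (twistComponent M m x) *
          (gradedAut M ^ (m + 1)).symm ((gradedAut M ^ (n + 1)) l) := by
      intro m x
      rw [twistComponent_mul_ofPoly hv, map_mul]
      congr 1
      rw [AlgEquiv.symm_apply_eq, pow_succ', AlgEquiv.mul_apply, AlgEquiv.apply_symm_apply]
    refine ⟨MulOpposite.op ⟨ZhangTwist.ofPoly M ((gradedAut M ^ (n + 1)) l), Algebra.subset_adjoin
      (mem_generatingSpace.2 ⟨_, mem_linearFormsAt.2 ⟨hv, ?_⟩, rfl⟩)⟩,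
      fun x hx => ⟨?_, fun m hm => ?_⟩⟩
    · have h := eval_gradedAut_pow M c (n + 1) (-(n : ℤ) - 1) l
      rw [hl'.2, show -(n : ℤ) - 1 + (n + 1 : ℕ) = 0 by omega] at h
      exact h
    · have h := hcomp n (x.unop : ZhangTwist M)
      rw [AlgEquiv.symm_apply_apply, mul_comm] at h
      exact h
    · obtain ⟨m, rfl⟩ := Nat.exists_eq_add_of_le' (show 1 ≤ m by omega)
      have h0 : (gradedAut M ^ m).symm (twistComponent M m (x.unop : ZhangTwist M)) = 0 :=
        hx m (by omega)
      have h := hcomp m (x.unop : ZhangTwist M)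
      rw [h0, zero_mul] at h
      exact h

end Noetherian

/-! ### The grading of `R` -/

section Grading

open MvPolynomial Submodule

variable {k : Type u} [Field k] {t : ℕ} {M : GL (Fin (t + 1)) k} {c : ℙ k (Fin (t + 1) → k)}

theorem mem_gradingR {n : ℕ} {x : algebraR M c} :
    x ∈ gradingR M c n ↔ ((ZhangTwist.ofPoly M).symm (x : ZhangTwist M)).IsHomogeneous n := by
  constructor
  · rintro ⟨f, hf, h⟩
    have : (x : ZhangTwist M) = ZhangTwist.ofPoly M f := h.symm
    rw [this, LinearEquiv.symm_apply_apply]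
    exact hf
  · intro h
    exact ⟨_, h, LinearEquiv.apply_symm_apply _ _⟩

theorem twistComponent_of_mem_gradingR {n : ℕ} {x : algebraR M c} (hx : x ∈ gradingR M c n)
    (m : ℕ) : twistComponent M m (x : ZhangTwist M) =
      if m = n then (ZhangTwist.ofPoly M).symm (x : ZhangTwist M) else 0 :=
  homogeneousComponent_of_mem (mem_gradingR.1 hx)

theorem gradedMonoid_gradingR (M : GL (Fin (t + 1)) k) (c : ℙ k (Fin (t + 1) → k)) :
    SetLike.GradedMonoid (gradingR M c) where
  one_mem := mem_gradingR.2 (isHomogeneous_one _ _)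
  mul_mem i j x y hx hy := by
    rw [mem_gradingR] at hx hy ⊢
    have h : (ZhangTwist.ofPoly M).symm ((x * y : algebraR M c) : ZhangTwist M) =
        twistMul M ((ZhangTwist.ofPoly M).symm (x : ZhangTwist M))
          ((ZhangTwist.ofPoly M).symm (y : ZhangTwist M)) := rfl
    rw [h, twistMul_of_isHomogeneous M _ hy]
    exact (gradedAut_pow_isHomogeneous M j hx).mul hy

theorem isInternal_gradingR [Infinite k]
    (hc : IsCriticallyDense (Set.range fun i : ℤ => M ^ (-i) • c)) :
    DirectSum.IsInternal (gradingR M c) := by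
  classical
  have key : ∀ (y : DirectSum ℕ fun n => gradingR M c n) (n : ℕ),
      twistComponent M n (DirectSum.coeAddMonoidHom (gradingR M c) y : algebraR M c) =
        (ZhangTwist.ofPoly M).symm ((y n : algebraR M c) : ZhangTwist M) := by
    intro y n
    induction y using DirectSum.induction_on with
    | zero => simp
    | of i x =>
      rw [DirectSum.coeAddMonoidHom_of, twistComponent_of_mem_gradingR x.2]
      split_ifs with h
      · subst h
        rw [DirectSum.of_eq_same]
      · rw [DirectSum.of_eq_of_ne _ _ _ h]
        simp
    | add a b ha hb =>
      rw [map_add, DirectSum.add_apply, Subalgebra.coe_add, map_add, ha, hb]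
      simp
  constructor
  · refine (injective_iff_map_eq_zero _).2 fun y hy => ?_
    refine DFinsupp.ext fun n => Subtype.ext (Subtype.ext ?_)
    have := key y n
    rw [hy] at this
    refine (ZhangTwist.ofPoly M).symm.injective ?_
    rw [← this]
    simp
  · intro x
    obtain ⟨N, hN⟩ := exists_forall_twistComponent_eq_zero M (x : ZhangTwist M)
    let f : (n : ℕ) → gradingR M c n := fun n =>
      ⟨⟨ZhangTwist.ofPoly M (twistComponent M n x),
        ofPoly_mem_algebraR ((mem_algebraR_iff hc).1 x.2 n)⟩,
        mem_gradingR.2 (twistComponent_isHomogeneous M n _)⟩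
    refine ⟨∑ n ∈ Finset.range N, DirectSum.of (fun n => gradingR M c n) n (f n), Subtype.ext ?_⟩
    rw [map_sum]
    simp only [DirectSum.coeAddMonoidHom_of]
    rw [AddSubmonoidClass.coe_finsetSum]
    exact sum_ofPoly_twistComponent M _ hN

theorem isConnectedGraded_gradingR [Infinite k]
    (hc : IsCriticallyDense (Set.range fun i : ℤ => M ^ (-i) • c)) :
    IsConnectedGraded (gradingR M c) where
  graded := by
    have := gradedMonoid_gradingR M c
    have := (isInternal_gradingR hc).chooseDecomposition
    exact ⟨{}⟩
  injective_algebraMap := by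
    intro a b hab
    have h : algebraMap k (ZhangTwist M) a = algebraMap k (ZhangTwist M) b :=
      congrArg Subtype.val hab
    rw [algebraMap_zhangTwist, algebraMap_zhangTwist] at h
    exact C_injective _ _ ((ZhangTwist.ofPoly M).injective h)
  zero_eq := by
    ext x
    rw [mem_gradingR, Submodule.mem_one]
    constructor
    · intro h
      refine ⟨coeff 0 ((ZhangTwist.ofPoly M).symm (x : ZhangTwist M)), Subtype.ext ?_⟩
      refine (algebraMap_zhangTwist M _).trans ((LinearEquiv.eq_symm_apply _).1 ?_)
      exact ((totalDegree_eq_zero_iff_eq_C).1 (Nat.le_zero.1 h.totalDegree_le)).symm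
    · rintro ⟨a, rfl⟩
      have h : ((algebraMap k (algebraR M c) a : algebraR M c) : ZhangTwist M) =
        ZhangTwist.ofPoly M (C a) := algebraMap_zhangTwist M a
      rw [h, LinearEquiv.symm_apply_apply]
      exact isHomogeneous_C _ a

theorem isFinitelyGeneratedInDegreeOne_gradingR (M : GL (Fin (t + 1)) k)
    (c : ℙ k (Fin (t + 1) → k)) : IsFinitelyGeneratedInDegreeOne (gradingR M c) where
  finite := by
    have hU : Module.Finite k (homogeneousSubmodule (Fin (t + 1)) k 1) :=
      Module.Finite.iff_fg.2 (homogeneousSubmodule_fg _ k 1)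
    refine Module.Finite.of_injective (LinearMap.codRestrict (homogeneousSubmodule (Fin (t + 1)) k 1)
      ((ZhangTwist.ofPoly M).symm.toLinearMap.comp
        ((algebraR M c).val.toLinearMap.comp (gradingR M c 1).subtype))
      fun x => mem_gradingR.1 x.2) fun x y h => ?_
    have h' := Subtype.ext_iff.1 h
    exact Subtype.ext (Subtype.ext ((ZhangTwist.ofPoly M).symm.injective h'))
  adjoin_eq_top := by
    refine top_le_iff.1 ((Algebra.adjoin_adjoin_coe_preimage (R := k)
      (s := generatingSpace M c)).ge.trans (Algebra.adjoin_mono fun x hx => ?_))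
    obtain ⟨f, hf, h⟩ := mem_generatingSpace.1 hx
    refine mem_gradingR.2 ?_
    rw [← h, LinearEquiv.symm_apply_apply]
    exact (mem_linearFormsAt.1 hf).1

end Grading

/-! ### Kronecker function rings of families of valuations -/

section KroneckerRing

variable {K : Type v} [Field K]

/-- The intersection of the valuation rings of the valuations `ν n`, as a `k`-subalgebra. -/
def valuationIntersection (k : Type u) [Field k] [Algebra k K] (ν : ℕ → AddValuation K (WithTop ℤ))
    (hk : ∀ n (a : k), 0 ≤ ν n (algebraMap k K a)) : Subalgebra k K where
  carrier := {x | ∀ n, 0 ≤ ν n x}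
  mul_mem' hx hy n := by rw [AddValuation.map_mul]; exact add_nonneg (hx n) (hy n)
  add_mem' hx hy n := (ν n).map_le_add (hx n) (hy n)
  algebraMap_mem' a n := hk n a

variable {k : Type u} [Field k] [Algebra k K] {ν : ℕ → AddValuation K (WithTop ℤ)}
  {hk : ∀ n (a : k), 0 ≤ ν n (algebraMap k K a)}

theorem div_mem_valuationIntersection {x y : K} (hy : y ≠ 0) (h : ∀ n, ν n y ≤ ν n x) :
    x / y ∈ valuationIntersection k ν hk := by
  intro n
  by_contra! hlt
  have hyt : ν n y ≠ ⊤ := (ν n).ne_top_iff.2 hy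
  have h1 : ν n x = ν n (x / y) + ν n y := by rw [← AddValuation.map_mul, div_mul_cancel₀ _ hy]
  have h2 : ν n x < 0 + ν n y := by
    rw [h1]
    exact (WithTop.add_lt_add_iff_right hyt).2 hlt
  rw [zero_add] at h2
  exact absurd (h n) (not_le.2 h2)

/-- The center of `ν n` on the intersection of the valuation rings. -/
def valuationCenter (k : Type u) [Field k] [Algebra k K] (ν : ℕ → AddValuation K (WithTop ℤ))
    (hk : ∀ n (a : k), 0 ≤ ν n (algebraMap k K a)) (n : ℕ) :
    Ideal (valuationIntersection k ν hk) where
  carrier := {x | 0 < ν n (x : K)}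
  zero_mem' := by simp
  add_mem' hx hy := (ν n).map_lt_add hx hy
  smul_mem' a x hx := by
    change 0 < ν n ((a : K) * (x : K))
    rw [AddValuation.map_mul]
    exact lt_of_lt_of_le hx (le_add_of_nonneg_left (a.2 n))

theorem mem_valuationCenter {n : ℕ} {x : valuationIntersection k ν hk} :
    x ∈ valuationCenter k ν hk n ↔ 0 < ν n (x : K) :=
  Iff.rfl

theorem isPrime_valuationCenter (n : ℕ) : (valuationCenter k ν hk n).IsPrime where
  ne_top' h := by
    have h1 : (1 : valuationIntersection k ν hk) ∈ valuationCenter k ν hk n := h ▸ trivial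
    rw [mem_valuationCenter] at h1
    simp at h1
  mem_or_mem' {x y} hxy := by
    by_contra! hcon
    simp only [mem_valuationCenter, not_lt] at hcon
    have h : 0 < ν n ((x : K) * (y : K)) := hxy
    rw [AddValuation.map_mul, le_antisymm hcon.1 (x.2 n), le_antisymm hcon.2 (y.2 n)] at h
    simp at h

/-- If any two elements have a combination with minimal values, and every nonzero element has
finitely many nonzero values, then the intersection of the valuation rings is a principal ideal
ring: a nonzero ideal is generated by an element with least sum of values. -/
theorem isPrincipalIdealRing_valuationIntersection
    (hfin : ∀ x : K, x ≠ 0 → {n | ν n x ≠ 0}.Finite)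
    (hgcd : ∀ x y : K, ∃ a ∈ valuationIntersection k ν hk,
      ∀ n, ν n (x + a * y) = min (ν n x) (ν n y)) :
    IsPrincipalIdealRing (valuationIntersection k ν hk) := by
  classical
  refine ⟨fun J => ?_⟩
  by_cases hJ : J = ⊥
  · exact hJ ▸ ⟨0, by simp⟩
  have hval : ∀ x : valuationIntersection k ν hk, x ≠ 0 → ∀ n, ∃ m : ℕ, ν n (x : K) = (m : ℤ) := by
    intro x hx n
    obtain ⟨m, hm⟩ := WithTop.ne_top_iff_exists.1
      ((ν n).ne_top_iff.2 (fun h => hx (Subtype.ext h) : (x : K) ≠ 0))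
    have h0 := x.2 n
    rw [← hm] at h0
    lift m to ℕ using (by exact_mod_cast h0)
    exact ⟨m, hm.symm⟩
  choose! val hvaleq using hval
  have hsupp : ∀ x : valuationIntersection k ν hk, x ≠ 0 → (Function.support (val x)).Finite := by
    intro x hx
    refine (hfin x fun h => hx (Subtype.ext h)).subset fun n hn h0 => hn ?_
    rw [hvaleq x hx n] at h0
    exact_mod_cast h0
  obtain ⟨x, ⟨hxJ, hx0⟩, hmin⟩ : ∃ x, (x ∈ J ∧ x ≠ 0) ∧
      ∀ y, y ∈ J ∧ y ≠ 0 → ∑ᶠ n, val x n ≤ ∑ᶠ n, val y n := by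
    obtain ⟨z, hz, hz0⟩ := J.ne_bot_iff.1 hJ
    obtain ⟨x, hx, hmin⟩ := exists_minimalFor_of_wellFoundedLT (fun x => x ∈ J ∧ x ≠ 0)
      (fun x => ∑ᶠ n, val x n) ⟨z, hz, hz0⟩
    exact ⟨x, hx, fun y hy => (le_total _ _).elim id (hmin hy)⟩
  refine ⟨x, le_antisymm (fun y hy => ?_) ((Ideal.span_singleton_le_iff_mem J).2 hxJ)⟩
  have hx0' : (x : K) ≠ 0 := fun h => hx0 (Subtype.ext h)
  obtain ⟨a, ha, haw⟩ := hgcd x y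
  let w : valuationIntersection k ν hk := x + ⟨a, ha⟩ * y
  have hw : ∀ n, ν n (w : K) = min (ν n (x : K)) (ν n (y : K)) := haw
  have hw0 : w ≠ 0 := by
    intro h
    have h1 := hw 0
    rw [h, ZeroMemClass.coe_zero, AddValuation.map_zero, eq_comm, min_eq_top] at h1
    exact hx0' ((ν 0).top_iff.1 h1.1)
  have hle : ∀ n, val w n ≤ val x n := by
    intro n
    have h1 : ν n (w : K) ≤ ν n (x : K) := (hw n).le.trans (min_le_left _ _)
    rw [hvaleq w hw0, hvaleq x hx0] at h1
    exact_mod_cast h1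
  have hsum := hmin w ⟨J.add_mem hxJ (J.mul_mem_left _ hy), hw0⟩
  rw [finsum_eq_sum_of_support_subset (s := (hsupp x hx0).toFinset) _ (by simp),
    finsum_eq_sum_of_support_subset (s := (hsupp x hx0).toFinset) _ (by
      intro n hn
      have := hle n
      have hn' : val w n ≠ 0 := hn
      simp only [Set.Finite.coe_toFinset, Function.mem_support]
      omega)] at hsum
  have heq := (Finset.sum_eq_sum_iff_of_le fun n _ => hle n).1
    (le_antisymm (Finset.sum_le_sum fun n _ => hle n) hsum)
  refine Ideal.mem_span_singleton'.2
    ⟨⟨(y : K) / x, div_mem_valuationIntersection hx0' fun n => ?_⟩, Subtype.ext ?_⟩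
  · have h1 : val w n = val x n := by
      by_cases hn : n ∈ (hsupp x hx0).toFinset
      · exact heq n hn
      · have h2 := hle n
        simp only [Set.Finite.mem_toFinset, Function.mem_support, not_not] at hn
        omega
    rw [hvaleq x hx0, ← h1, ← hvaleq w hw0, hw n]
    exact min_le_right _ _
  · exact div_mul_cancel₀ _ hx0'

end KroneckerRing

/-! ### Gauss extensions -/

section GaussOrder

variable {A : Type u} {D : Type v} [CommRing A] [CommRing D]

/-- The extension of a homomorphism `φ : A → D[s]` to a homomorphism `A[τ] → D[τ][s]` that
fixes `τ`. -/
noncomputable def gaussExpansion (φ : A →+* Polynomial D) :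
    Polynomial A →+* Polynomial (Polynomial D) :=
  Polynomial.eval₂RingHom ((Polynomial.mapRingHom Polynomial.C).comp φ)
    (Polynomial.C Polynomial.X)

theorem coeff_coeff_gaussExpansion (φ : A →+* Polynomial D) (a : Polynomial A) (i j : ℕ) :
    ((gaussExpansion φ a).coeff j).coeff i = (φ (a.coeff i)).coeff j := by
  induction a using Polynomial.induction_on' with
  | add a b ha hb => simp only [map_add, Polynomial.coeff_add, ha, hb]
  | monomial n f =>
    rw [gaussExpansion, Polynomial.coe_eval₂RingHom, Polynomial.eval₂_monomial, ← Polynomial.C_pow,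
      Polynomial.coeff_mul_C]
    simp only [RingHom.comp_apply, Polynomial.coe_mapRingHom, Polynomial.coeff_map]
    rw [Polynomial.coeff_C_mul_X_pow, Polynomial.coeff_monomial]
    simp only [eq_comm (a := i)]
    split_ifs <;> simp

/-- The homomorphism `gaussExpansion φ` with values in Laurent series in `s` over a field. -/
noncomputable def laurentExpansion (φ : A →+* Polynomial D) :
    Polynomial A →+* LaurentSeries (FractionRing (Polynomial D)) :=
  (HahnSeries.ofPowerSeries ℤ _).comp (Polynomial.coeToPowerSeries.ringHom.comp
    ((Polynomial.mapRingHom (algebraMap (Polynomial D) (FractionRing (Polynomial D)))).comp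
      (gaussExpansion φ)))

theorem coeff_laurentExpansion_eq_zero_iff (φ : A →+* Polynomial D) (a : Polynomial A) (j : ℤ) :
    (laurentExpansion φ a).coeff j = 0 ↔
      j < 0 ∨ ∀ i, (φ (a.coeff i)).coeff j.natAbs = 0 := by
  have h : (laurentExpansion φ a).coeff j = if j < 0 then 0 else
      algebraMap _ (FractionRing (Polynomial D)) ((gaussExpansion φ a).coeff j.natAbs) := by
    rw [laurentExpansion]
    simp only [RingHom.comp_apply]
    rw [PowerSeries.coeff_coe]
    simp
  rw [h]
  split_ifs with hj
  · simp [hj]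
  · rw [map_eq_zero_iff _ (IsFractionRing.injective _ _), Polynomial.ext_iff]
    simp [coeff_coeff_gaussExpansion, hj]

theorem laurentExpansion_injective {φ : A →+* Polynomial D} (hφ : Function.Injective φ) :
    Function.Injective (laurentExpansion φ) := by
  refine (injective_iff_map_eq_zero _).2 fun a ha => Polynomial.ext fun i => ?_
  refine hφ (Polynomial.ext fun j => ?_)
  have h := (coeff_laurentExpansion_eq_zero_iff φ a (j : ℤ)).1 (by rw [ha]; rfl)
  simpa using (h.resolve_left (by omega)) i

variable [IsDomain A] [IsDomain D]

/-- The Gauss extension of the order in `s` along `φ : A → D[s]` to the fraction field of `A[τ]`: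
the value of a polynomial in `τ` is the least order of its coefficients. -/
noncomputable def gaussOrder (φ : A →+* Polynomial D) (hφ : Function.Injective φ) :
    AddValuation (FractionRing (Polynomial A)) (WithTop ℤ) :=
  (HahnSeries.addVal ℤ (FractionRing (Polynomial D))).comap
    (IsFractionRing.lift (laurentExpansion_injective hφ))

variable {φ : A →+* Polynomial D} {hφ : Function.Injective φ}

theorem le_gaussOrder_algebraMap_iff {a : Polynomial A} {r : WithTop ℤ} :
    r ≤ gaussOrder φ hφ (algebraMap (Polynomial A) _ a) ↔
      ∀ j : ℤ, j < r → j < 0 ∨ ∀ i, (φ (a.coeff i)).coeff j.natAbs = 0 := by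
  have h : gaussOrder φ hφ (algebraMap (Polynomial A) _ a) = (laurentExpansion φ a).orderTop := by
    rw [← HahnSeries.addVal_apply, ← IsFractionRing.lift_algebraMap
      (K := FractionRing (Polynomial A)) (laurentExpansion_injective hφ) a]
    rfl
  rw [h, HahnSeries.le_orderTop_iff_forall]
  simp only [coeff_laurentExpansion_eq_zero_iff]

theorem gaussOrder_algebraMap_nonneg (a : Polynomial A) :
    0 ≤ gaussOrder φ hφ (algebraMap (Polynomial A) _ a) :=
  le_gaussOrder_algebraMap_iff.2 fun _ hj => Or.inl (WithTop.coe_lt_coe.1 hj)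

theorem gaussOrder_algebraMap_pos_iff {a : Polynomial A} :
    0 < gaussOrder φ hφ (algebraMap (Polynomial A) _ a) ↔ ∀ i, (φ (a.coeff i)).coeff 0 = 0 := by
  have h1 : ∀ x : WithTop ℤ, 0 < x ↔ ((1 : ℤ) : WithTop ℤ) ≤ x := by
    intro x
    induction x with
    | top => simp
    | coe x => norm_cast
  rw [h1, le_gaussOrder_algebraMap_iff]
  constructor
  · intro h
    exact (h 0 (by norm_cast)).resolve_left (by omega)
  · intro h j hj
    have hj' : j < 1 := WithTop.coe_lt_coe.1 hj
    rcases lt_or_ge j 0 with h0 | h0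
    · exact Or.inl h0
    · obtain rfl : j = 0 := by omega
      exact Or.inr h

/-- For `N` larger than the degree of `a`, the polynomial `a + τ^N b` collects the coefficients of
`a` and `b`. -/
theorem gaussOrder_add_X_pow_mul {a b : Polynomial A} {N : ℕ} (hN : a.natDegree < N) :
    gaussOrder φ hφ (algebraMap (Polynomial A) _ (a + Polynomial.X ^ N * b)) =
      min (gaussOrder φ hφ (algebraMap (Polynomial A) _ a))
        (gaussOrder φ hφ (algebraMap (Polynomial A) _ b)) := by
  refine eq_of_forall_le_iff fun r => ?_
  rw [le_min_iff, le_gaussOrder_algebraMap_iff, le_gaussOrder_algebraMap_iff,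
    le_gaussOrder_algebraMap_iff, ← forall₂_and]
  refine forall₂_congr fun j _ => ?_
  rw [← or_and_left]
  refine or_congr_right ⟨fun h => ⟨fun i => ?_, fun i => ?_⟩, fun h i => ?_⟩
  · rcases lt_or_ge i N with hi | hi
    · have := h i
      rwa [Polynomial.coeff_add, Polynomial.coeff_X_pow_mul', if_neg (by omega), add_zero] at this
    · rw [Polynomial.coeff_eq_zero_of_natDegree_lt (hN.trans_le hi)]
      simp
  · have := h (i + N)
    rwa [Polynomial.coeff_add, Polynomial.coeff_X_pow_mul,
      Polynomial.coeff_eq_zero_of_natDegree_lt (p := a) (by omega), zero_add] at this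
  · rw [Polynomial.coeff_add, Polynomial.coeff_X_pow_mul', map_add, Polynomial.coeff_add, h.1 i,
      zero_add]
    split_ifs
    · exact h.2 _
    · simp

/-- Any two elements of the fraction field of `A[τ]` have a combination with minimal values, for all
Gauss extensions at once. -/
theorem exists_gaussOrder_eq_min (x y : FractionRing (Polynomial A)) :
    ∃ N : ℕ, ∀ (D : Type v) [CommRing D] [IsDomain D] (φ : A →+* Polynomial D)
      (hφ : Function.Injective φ),
      gaussOrder φ hφ (x + algebraMap (Polynomial A) _ (Polynomial.X ^ N) * y) =
        min (gaussOrder φ hφ x) (gaussOrder φ hφ y) := by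
  obtain ⟨a, b, hb, rfl⟩ := IsFractionRing.div_surjective (A := Polynomial A) x
  obtain ⟨c, d, hd, rfl⟩ := IsFractionRing.div_surjective (A := Polynomial A) y
  have hb0 : algebraMap _ (FractionRing (Polynomial A)) b ≠ 0 :=
    IsFractionRing.to_map_ne_zero_of_mem_nonZeroDivisors hb
  have hd0 : algebraMap _ (FractionRing (Polynomial A)) d ≠ 0 :=
    IsFractionRing.to_map_ne_zero_of_mem_nonZeroDivisors hd
  refine ⟨(a * d).natDegree + 1, fun D _ _ φ hφ => ?_⟩
  have h := gaussOrder_add_X_pow_mul (hφ := hφ) (b := c * b) (Nat.lt_succ_self (a * d).natDegree)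
  have he : gaussOrder φ hφ (algebraMap _ (FractionRing (Polynomial A)) (b * d)) ≠ ⊤ := by
    rw [AddValuation.ne_top_iff, map_mul]
    exact mul_ne_zero hb0 hd0
  refine (WithTop.add_right_inj he).1 ?_
  rw [← min_add_add_right, ← AddValuation.map_mul, ← AddValuation.map_mul, ← AddValuation.map_mul]
  convert h using 2
  · simp only [map_mul, map_add, map_pow, Nat.succ_eq_add_one]
    field_simp
  · congr 1
    simp only [map_mul]
    field_simp
  · congr 1
    simp only [map_mul]
    field_simp

end GaussOrder

/-! ### Order of vanishing along the lines of an affine space -/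

section LineOrder

open MvPolynomial

variable {k : Type u} [Field k] {σ : Type}

/-- The expansion `f ↦ f (λ w + s z)` of a polynomial along the line spanned by the vector `w`,
as a polynomial in `s` (outer variable) and `λ` (inner variable) over `k[z]`. -/
noncomputable def lineExpansion (w : σ → k) :
    MvPolynomial σ k →ₐ[k] Polynomial (Polynomial (MvPolynomial σ k)) :=
  aeval fun i => Polynomial.C (Polynomial.C (C (w i)) * Polynomial.X) +
    Polynomial.X * Polynomial.C (Polynomial.C (X i))

theorem lineExpansion_injective (w : σ → k) : Function.Injective (lineExpansion w) := by
  -- The polynomial is recovered at `λ = 0`, `s = 1`.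
  have h : ((Polynomial.evalRingHom 0).comp (Polynomial.evalRingHom 1)).comp
      (lineExpansion w : MvPolynomial σ k →+* _) = RingHom.id (MvPolynomial σ k) := by
    refine MvPolynomial.ringHom_ext (fun a => ?_) fun i => ?_
    · have : lineExpansion w (C a) = Polynomial.C (Polynomial.C (C a)) :=
        (lineExpansion w).commutes a
      simp [this]
    · simp [lineExpansion]
  intro f g hfg
  have := congrArg ((Polynomial.evalRingHom 0).comp (Polynomial.evalRingHom 1)) hfg
  have hf := DFunLike.congr_fun h f
  have hg := DFunLike.congr_fun h g
  simp only [RingHom.comp_apply, RingHom.coe_coe, RingHom.id_apply] at hf hg this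
  rw [← hf, ← hg, this]

/-- The restriction of `f` to the line spanned by `w` is the polynomial `∑ m, f_m(w) λ^m`, for
`f_m` the homogeneous components. -/
theorem coeff_coeff_zero_lineExpansion (w : σ → k) (f : MvPolynomial σ k) (m : ℕ) :
    ((lineExpansion w f).coeff 0).coeff m = C (eval w (homogeneousComponent m f)) := by
  induction f using MvPolynomial.induction_on' with
  | add a b ha hb => simp only [map_add, Polynomial.coeff_add, ha, hb]
  | monomial d a =>
    have h0 : (lineExpansion w (monomial d a)).coeff 0 =
        Polynomial.C (C (eval w (monomial d a))) * Polynomial.X ^ d.degree := by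
      rw [Polynomial.coeff_zero_eq_eval_zero]
      rw [lineExpansion, aeval_monomial, Polynomial.eval_mul, Finsupp.prod, Polynomial.eval_prod]
      simp only [Polynomial.eval_pow, Polynomial.eval_add, Polynomial.eval_C, Polynomial.eval_mul,
        Polynomial.eval_X, zero_mul, add_zero, mul_pow, Finset.prod_mul_distrib,
        Finset.prod_pow_eq_pow_sum]
      rw [eval_monomial, Finsupp.prod, C_mul, Polynomial.C_mul, map_prod, map_prod, ← mul_assoc]
      simp only [map_pow]
      congr 2
      exact Polynomial.eval_C
    have hs : (monomial d a).IsHomogeneous d.degree := isHomogeneous_monomial a rfl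
    rw [h0, homogeneousComponent_of_mem hs, Polynomial.coeff_C_mul_X_pow]
    split_ifs <;> simp

/-- There is a noetherian ring `B`, a point `y` of affine space over `B` and primes `𝔭 n` of `B`, such
that `y` specializes at `𝔭 n` to the generic point of the line spanned by `w n`, while the values
at `y` of any two forms are, up to a common factor, not both in `𝔭 n`. The ring is the Kronecker
function ring of the orders of vanishing along these lines; thus `𝔭 n` is the generic point of the
exceptional divisor of a blowup at `w n`. -/
theorem IsGenericSequence.exists_noetherian_base {w : ℕ → σ → k} (hw : IsGenericSequence w) :
    ∃ (B : Type u) (_ : CommRing B) (_ : Algebra k B) (y : MvPolynomial σ k →ₐ[k] B)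
      (𝔭 : ℕ → Ideal B), IsNoetherianRing B ∧ (∀ n, (𝔭 n).IsPrime) ∧
      (∀ n m f, f.IsHomogeneous m → (y f ∈ 𝔭 n ↔ eval (w n) f = 0)) ∧
      ∀ f g, f ≠ 0 → ∃ α β, α * y f = β * y g ∧ ∀ n, α ∉ 𝔭 n ∨ β ∉ 𝔭 n := by
  let P := Polynomial (MvPolynomial σ k)
  let K := FractionRing P
  let ν : ℕ → AddValuation K (WithTop ℤ) := fun n =>
    gaussOrder (lineExpansion (w n)).toRingHom (lineExpansion_injective (w n))
  have hν0 : ∀ n (a : P), 0 ≤ ν n (algebraMap P K a) := fun n a => gaussOrder_algebraMap_nonneg a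
  have hνpos : ∀ n (a : P), 0 < ν n (algebraMap P K a) ↔
      ∀ i m, eval (w n) (homogeneousComponent m (a.coeff i)) = 0 := by
    intro n a
    refine gaussOrder_algebraMap_pos_iff.trans (forall_congr' fun i => ?_)
    refine Polynomial.ext_iff.trans (forall_congr' fun m => ?_)
    refine (Eq.congr_left (coeff_coeff_zero_lineExpansion (w n) (a.coeff i) m)).trans ?_
    simp
  have hνC : ∀ n m f, f.IsHomogeneous m →
      (0 < ν n (algebraMap P K (Polynomial.C f)) ↔ eval (w n) f = 0) := by
    intro n m f hf
    rw [hνpos]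
    constructor
    · intro h
      have := h 0 m
      rwa [Polynomial.coeff_C_zero, homogeneousComponent_eq_self hf] at this
    · intro h i m'
      rw [Polynomial.coeff_C]
      split_ifs
      · rw [homogeneousComponent_of_mem hf]
        split_ifs
        · exact h
        · simp
      · simp
  have hk : ∀ n (a : k), 0 ≤ ν n (algebraMap k K a) := fun n a => by
    rw [IsScalarTower.algebraMap_apply k P K]
    exact hν0 n _
  have hfin : ∀ x : K, x ≠ 0 → {n | ν n x ≠ 0}.Finite := by
    have hP : ∀ a : P, a ≠ 0 → {n | ν n (algebraMap P K a) ≠ 0}.Finite := by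
      intro a ha
      obtain ⟨i, hi⟩ : ∃ i, a.coeff i ≠ 0 := by
        by_contra! h
        exact ha (Polynomial.ext h)
      obtain ⟨m, hm⟩ : ∃ m, homogeneousComponent m (a.coeff i) ≠ 0 := by
        by_contra! h
        refine hi ?_
        rw [← sum_homogeneousComponent (a.coeff i)]
        exact Finset.sum_eq_zero fun m _ => h m
      refine (hw.finite_zeros m _ (homogeneousComponent_isHomogeneous m _) hm).subset fun n hn => ?_
      exact (hνpos n a).1 (lt_of_le_of_ne (hν0 n a) (Ne.symm hn)) i m
    intro x hx
    obtain ⟨a, b, hb, rfl⟩ := IsFractionRing.div_surjective (A := P) x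
    have ha : a ≠ 0 := by
      rintro rfl
      simp at hx
    refine ((hP a ha).union (hP b (nonZeroDivisors.ne_zero hb))).subset fun n hn => ?_
    by_contra hcon
    simp only [Set.mem_union, Set.mem_ofPred_eq, not_or, not_not] at hcon
    exact hn (by rw [AddValuation.map_div, hcon.1, hcon.2, sub_zero])
  have hgcd : ∀ x y : K, ∃ a ∈ valuationIntersection k ν hk,
      ∀ n, ν n (x + a * y) = min (ν n x) (ν n y) := by
    intro x y
    obtain ⟨N, hN⟩ := exists_gaussOrder_eq_min.{u, u} x y
    exact ⟨algebraMap P K (Polynomial.X ^ N), fun n => hν0 n _, fun n => hN _ _ _⟩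
  have hPID := isPrincipalIdealRing_valuationIntersection hfin hgcd
  let y : MvPolynomial σ k →ₐ[k] valuationIntersection k ν hk :=
    ((IsScalarTower.toAlgHom k P K).comp Polynomial.CAlgHom).codRestrict _ fun f n => hν0 n _
  have hy : ∀ f, (y f : K) = algebraMap P K (Polynomial.C f) := fun f => rfl
  refine ⟨valuationIntersection k ν hk, inferInstance, inferInstance, y, valuationCenter k ν hk,
    inferInstance, isPrime_valuationCenter, fun n m f hf => ?_, fun f g hf => ?_⟩
  · rw [mem_valuationCenter, hy]
    exact hνC n m f hf
  · -- The element `f + τ g` is a greatest common divisor of the values of `f` and `g`.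
    let d : K := algebraMap P K (Polynomial.C f + Polynomial.X ^ 1 * Polynomial.C g)
    have hd : ∀ n, ν n d = min (ν n (y f)) (ν n (y g)) := fun n =>
      gaussOrder_add_X_pow_mul (by simp)
    have hd0 : d ≠ 0 := by
      intro h
      have h1 := (map_eq_zero_iff _ (IsFractionRing.injective P K)).1 h
      have h2 := congrArg (fun q => Polynomial.coeff q 0) h1
      refine hf ?_
      change (Polynomial.C f + Polynomial.X ^ 1 * Polynomial.C g).coeff 0 = 0 at h2
      rwa [pow_one, Polynomial.coeff_add, Polynomial.coeff_C_zero, Polynomial.coeff_X_mul_zero,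
        add_zero] at h2
    refine ⟨⟨(y g : K) / d, div_mem_valuationIntersection hd0 fun n => ?_⟩,
      ⟨(y f : K) / d, div_mem_valuationIntersection hd0 fun n => ?_⟩, Subtype.ext ?_, fun n => ?_⟩
    · exact (hd n).le.trans (min_le_right _ _)
    · exact (hd n).le.trans (min_le_left _ _)
    · change (y g : K) / d * (y f : K) = (y f : K) / d * (y g : K)
      ring
    · have hdt : ν n d ≠ ⊤ := (ν n).ne_top_iff.2 hd0
      have key : ∀ z : K, ν n d = ν n z → ¬ 0 < ν n (z / d) := by
        intro z hz hpos
        have h1 : ν n z = ν n (z / d) + ν n d := by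
          rw [← AddValuation.map_mul, div_mul_cancel₀ _ hd0]
        have h2 : 0 + ν n d < ν n (z / d) + ν n d := (WithTop.add_lt_add_iff_right hdt).2 hpos
        rw [← h1, ← hz, zero_add] at h2
        exact lt_irrefl _ h2
      rw [mem_valuationCenter, mem_valuationCenter]
      rcases min_choice (ν n (y f)) (ν n (y g)) with h | h
      · exact Or.inr (key _ ((hd n).trans h))
      · exact Or.inl (key _ ((hd n).trans h))

end LineOrder

/-! ### Failure of the strong noetherian property -/

section NotStronglyNoetherian

open MvPolynomial Submodule

variable {k : Type u} [Field k] {t : ℕ} {M : GL (Fin (t + 1)) k} {c : ℙ k (Fin (t + 1) → k)}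
  {B : Type u} [CommRing B] [Algebra k B]

/-- The `B`-linear extension to `R ⊗ B` of the functional `r ↦ f (r_n)`, for a linear map `f` on
polynomials with values in `B`. -/
noncomputable def componentFunctional (M : GL (Fin (t + 1)) k) (c : ℙ k (Fin (t + 1) → k))
    (f : MvPolynomial (Fin (t + 1)) k →ₗ[k] B) (n : ℕ) : algebraR M c ⊗[k] B →ₗ[k] B :=
  (LinearMap.mul' k B).comp (TensorProduct.map
    (f.comp ((twistComponent M n).comp (algebraR M c).val.toLinearMap)) LinearMap.id)

theorem componentFunctional_tmul (f : MvPolynomial (Fin (t + 1)) k →ₗ[k] B) (n : ℕ)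
    (r : algebraR M c) (b : B) : componentFunctional M c f n (r ⊗ₜ b) =
      f (twistComponent M n (r : ZhangTwist M)) * b :=
  rfl

/-- Evaluation of the degree `n` component at the vector `w`, extended to `R ⊗ B`. -/
noncomputable def pointFunctional (M : GL (Fin (t + 1)) k) (c : ℙ k (Fin (t + 1) → k))
    (B : Type u) [CommRing B] [Algebra k B] (w : Fin (t + 1) → k) (n : ℕ) :
    algebraR M c ⊗[k] B →ₗ[k] B :=
  componentFunctional M c ((Algebra.linearMap k B).comp (aeval (R := k) w).toLinearMap) n

/-- The `i`-th partial derivative at `w` of the degree `n` component, extended to `R ⊗ B`. -/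
noncomputable def derivFunctional (M : GL (Fin (t + 1)) k) (c : ℙ k (Fin (t + 1) → k))
    (B : Type u) [CommRing B] [Algebra k B] (w : Fin (t + 1) → k) (i : Fin (t + 1)) (n : ℕ) :
    algebraR M c ⊗[k] B →ₗ[k] B :=
  componentFunctional M c ((Algebra.linearMap k B).comp
    ((aeval (R := k) w).toLinearMap.comp (pderiv i).toLinearMap)) n

theorem pointFunctional_tmul (w : Fin (t + 1) → k) (n : ℕ) (r : algebraR M c) (b : B) :
    pointFunctional M c B w n (r ⊗ₜ b) =
      algebraMap k B (eval w (twistComponent M n (r : ZhangTwist M))) * b := by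
  rw [← aeval_eq_eval]
  rfl

theorem derivFunctional_tmul (w : Fin (t + 1) → k) (i : Fin (t + 1)) (n : ℕ) (r : algebraR M c)
    (b : B) : derivFunctional M c B w i n (r ⊗ₜ b) =
      algebraMap k B (eval w (pderiv i (twistComponent M n (r : ZhangTwist M)))) * b := by
  rw [← aeval_eq_eval]
  rfl

theorem pointFunctional_tmul_mul (w : Fin (t + 1) → k) (n : ℕ) (r : algebraR M c) (b : B)
    (x : algebraR M c ⊗[k] B) : pointFunctional M c B w n (r ⊗ₜ b * x) =
      ∑ j ∈ Finset.range (n + 1), algebraMap k B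
        (eval w ((gradedAut M ^ j) (twistComponent M (n - j) (r : ZhangTwist M)))) * b *
          pointFunctional M c B w j x := by
  induction x using TensorProduct.induction_on with
  | zero => simp
  | add x y hx hy => simp only [mul_add, map_add, hx, hy, Finset.sum_add_distrib]
  | tmul s e =>
    rw [Algebra.TensorProduct.tmul_mul_tmul, pointFunctional_tmul, Subalgebra.coe_mul,
      twistComponent_mul, map_sum, map_sum, Finset.sum_mul]
    refine Finset.sum_congr rfl fun j _ => ?_
    rw [pointFunctional_tmul, map_mul, map_mul]
    ring

theorem derivFunctional_tmul_mul (w : Fin (t + 1) → k) (i : Fin (t + 1)) (n : ℕ)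
    (r : algebraR M c) (b : B) (x : algebraR M c ⊗[k] B) :
    derivFunctional M c B w i n (r ⊗ₜ b * x) = ∑ j ∈ Finset.range (n + 1),
      (algebraMap k B
        (eval w ((gradedAut M ^ j) (twistComponent M (n - j) (r : ZhangTwist M)))) * b *
          derivFunctional M c B w i j x +
      algebraMap k B
        (eval w (pderiv i ((gradedAut M ^ j) (twistComponent M (n - j) (r : ZhangTwist M))))) * b *
          pointFunctional M c B w j x) := by
  induction x using TensorProduct.induction_on with
  | zero => simp
  | add x y hx hy =>
    simp only [mul_add, map_add, hx, hy, ← Finset.sum_add_distrib]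
    exact Finset.sum_congr rfl fun j _ => by ring
  | tmul s e =>
    rw [Algebra.TensorProduct.tmul_mul_tmul, derivFunctional_tmul, Subalgebra.coe_mul,
      twistComponent_mul, map_sum, map_sum, map_sum, Finset.sum_mul]
    refine Finset.sum_congr rfl fun j _ => ?_
    rw [pointFunctional_tmul, derivFunctional_tmul, pderiv_mul]
    simp only [map_add, map_mul]
    ring

/-- The elements of `R ⊗ B` that modulo `𝔭` vanish at `c_N` in degrees at most `N` and have
vanishing `i`-th derivative at `c_N` in degree `N + 1`. They form a left ideal because the elements
of `R` of positive degree, moved to degree `N + 1`, vanish at `c_N`. -/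
noncomputable def tangencyIdeal [Infinite k]
    (hc : IsCriticallyDense (Set.range fun i : ℤ => M ^ (-i) • c)) (𝔭 : Ideal B)
    (N : ℕ) (i : Fin (t + 1)) : Ideal (algebraR M c ⊗[k] B) where
  carrier := {x | (∀ n ≤ N, pointFunctional M c B (orbitVec M c N) n x ∈ 𝔭) ∧
    derivFunctional M c B (orbitVec M c N) i (N + 1) x ∈ 𝔭}
  zero_mem' := by simp
  add_mem' hx hy := ⟨fun n hn => by rw [map_add]; exact 𝔭.add_mem (hx.1 n hn) (hy.1 n hn),
    by rw [map_add]; exact 𝔭.add_mem hx.2 hy.2⟩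
  smul_mem' s x hx := by
    rw [smul_eq_mul]
    induction s using TensorProduct.induction_on with
    | zero => simp
    | add s₁ s₂ h₁ h₂ =>
      rw [add_mul]
      exact ⟨fun n hn => by rw [map_add]; exact 𝔭.add_mem (h₁.1 n hn) (h₂.1 n hn),
        by rw [map_add]; exact 𝔭.add_mem h₁.2 h₂.2⟩
    | tmul r b =>
      refine ⟨fun n hn => ?_, ?_⟩
      · rw [pointFunctional_tmul_mul]
        refine 𝔭.sum_mem fun j hj => 𝔭.mul_mem_left _ (hx.1 j ?_)
        have := Finset.mem_range.1 hj
        omega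
      · rw [derivFunctional_tmul_mul]
        refine 𝔭.sum_mem fun j hj => ?_
        have hj' := Finset.mem_range.1 hj
        rcases Nat.lt_or_ge N j with h | h
        · obtain rfl : j = N + 1 := by omega
          have h0 := (twistComponent_isHomogeneous M 0 (r : ZhangTwist M))
          have h1 : pderiv i
              ((gradedAut M ^ (N + 1)) (twistComponent M 0 (r : ZhangTwist M))) = 0 := by
            rw [(totalDegree_eq_zero_iff_eq_C).1
              (Nat.le_zero.1 (gradedAut_pow_isHomogeneous M (N + 1) h0).totalDegree_le), pderiv_C]
          rw [Nat.sub_self, h1, map_zero, map_zero, zero_mul, zero_mul, add_zero]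
          exact 𝔭.mul_mem_left _ hx.2
        · obtain ⟨m, rfl⟩ := Nat.exists_eq_add_of_le h
          have h1 : eval (orbitVec M c (j + m : ℕ)) ((gradedAut M ^ j)
              (twistComponent M (j + m + 1 - j) (r : ZhangTwist M))) = 0 := by
            rw [Nat.cast_add, add_comm (j : ℤ), eval_gradedAut_pow]
            exact ((mem_partR hc).1 ((mem_algebraR_iff hc).1 r.2 (j + m + 1 - j))).2 m (by omega)
          rw [h1, map_zero, zero_mul, zero_mul, zero_add]
          exact 𝔭.mul_mem_left _ (hx.1 j h)

theorem mem_tangencyIdeal [Infinite k]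
    {hc : IsCriticallyDense (Set.range fun i : ℤ => M ^ (-i) • c)} {𝔭 : Ideal B}
    {N : ℕ} {i : Fin (t + 1)} {x : algebraR M c ⊗[k] B} :
    x ∈ tangencyIdeal hc 𝔭 N i ↔
      (∀ n ≤ N, pointFunctional M c B (orbitVec M c N) n x ∈ 𝔭) ∧
        derivFunctional M c B (orbitVec M c N) i (N + 1) x ∈ 𝔭 :=
  Iff.rfl

/-- If a `B`-valued point `y` specializes to `w` at the prime `𝔭`, then every element of `R ⊗ B`
that vanishes at `y` in degree `n` vanishes at `w` modulo `𝔭` in degree `n`. -/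
theorem pointFunctional_mem {𝔭 : Ideal B} [𝔭.IsPrime] {y : MvPolynomial (Fin (t + 1)) k →ₐ[k] B}
    {w : Fin (t + 1) → k} (hw : w ≠ 0) (hy : ∀ m f, f.IsHomogeneous m → (y f ∈ 𝔭 ↔ eval w f = 0))
    {n : ℕ} {x : algebraR M c ⊗[k] B} (hx : componentFunctional M c y.toLinearMap n x = 0) :
    pointFunctional M c B w n x ∈ 𝔭 := by
  obtain ⟨i, hi⟩ := Function.ne_iff.1 hw
  have key : ∀ x : algebraR M c ⊗[k] B,
      algebraMap k B (w i ^ n) * componentFunctional M c y.toLinearMap n x -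
        y (X i) ^ n * pointFunctional M c B w n x ∈ 𝔭 := by
    intro x
    induction x using TensorProduct.induction_on with
    | zero => simp
    | add a b ha hb =>
      have := 𝔭.add_mem ha hb
      simp only [map_add]
      convert this using 1
      ring
    | tmul r b =>
      set f := twistComponent M n (r : ZhangTwist M) with hf
      have hfn : f.IsHomogeneous n := twistComponent_isHomogeneous M n _
      have h1 : (C (w i ^ n) * f - C (eval w f) * X i ^ n).IsHomogeneous n :=
        (hfn.C_mul _).sub ((isHomogeneous_X_pow i n).C_mul _)
      have h2 := (hy n _ h1).2 (by simp [mul_comm])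
      have hC : ∀ a : k, y (C a) = algebraMap k B a := fun a => y.commutes a
      rw [map_sub, map_mul, map_mul, hC, hC, map_pow y] at h2
      have := 𝔭.mul_mem_right b h2
      rw [componentFunctional_tmul, pointFunctional_tmul, ← hf]
      convert this using 1
      change _ * (y f * b) - _ = _
      ring
  have h := key x
  rw [hx, mul_zero, zero_sub, neg_mem_iff] at h
  refine (Ideal.IsPrime.mem_or_mem ‹𝔭.IsPrime› h).resolve_left fun h1 => hi ?_
  have h2 := Ideal.IsPrime.mem_of_pow_mem ‹𝔭.IsPrime› _ h1
  simpa using (hy 1 _ (isHomogeneous_X k i)).1 h2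

theorem exists_mem_partR_eval_ne_zero [Infinite k]
    (hc : IsCriticallyDense (Set.range fun i : ℤ => M ^ (-i) • c)) (N : ℕ) :
    ∃ F ∈ partR M c N, eval (orbitVec M c N) F ≠ 0 := by
  have hgen := isGenericSequence_orbitVec hc (s := fun n : ℕ => (n : ℤ)) Nat.cast_injective
  have key : ∀ n ≤ N, ∃ F ∈ partR M c n, eval (orbitVec M c N) F ≠ 0 := by
    intro n hn
    induction n with
    | zero => exact ⟨1, by simp [partR, Submodule.one_le.1 le_rfl], by simp⟩
    | succ n ih =>
      obtain ⟨F, hF, hF0⟩ := ih (by omega)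
      obtain ⟨l, hl, hl0⟩ := hgen.exists_linearForm n N (by omega)
      refine ⟨F * l, ?_, by rw [map_mul]; exact mul_ne_zero hF0 hl0⟩
      rw [partR, Finset.prod_range_succ]
      exact Submodule.mul_mem_mul hF hl
  exact key N le_rfl

/-- The element of degree `N + 1` is `ρ₁ ⊗ α - ρ₂ ⊗ β`, where `ρ₁` and `ρ₂` are the products of a
form in `R_N` not vanishing at `c_N` with two independent linear forms `l₁`, `l₂` at `c_N` (which
exist as `t ≥ 2`), and `α l₁(y) = β l₂(y)`. It vanishes at `y`, hence modulo `𝔭 m` at `c_m` for all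
`m`, but its derivatives at `c_N` are unit multiples of `α` and `β` and are not all in `𝔭 N`. -/
theorem exists_tangency_witness [Infinite k] (ht : 2 ≤ t)
    (hc : IsCriticallyDense (Set.range fun i : ℤ => M ^ (-i) • c))
    {y : MvPolynomial (Fin (t + 1)) k →ₐ[k] B} {𝔭 : ℕ → Ideal B} (h𝔭 : ∀ n, (𝔭 n).IsPrime)
    (hy : ∀ n m f, f.IsHomogeneous m → (y f ∈ 𝔭 n ↔ eval (orbitVec M c n) f = 0))
    (hgcd : ∀ f g, f ≠ 0 → ∃ α β, α * y f = β * y g ∧ ∀ n, α ∉ 𝔭 n ∨ β ∉ 𝔭 n) (N : ℕ) :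
    ∃ ξ : algebraR M c ⊗[k] B, (∃ i, ξ ∉ tangencyIdeal hc (𝔭 N) N i) ∧
      ∀ m > N, ∀ i, ξ ∈ tangencyIdeal hc (𝔭 m) m i := by
  obtain ⟨F, hF, hF0⟩ := exists_mem_partR_eval_ne_zero hc N
  set w := orbitVec M c N with hw
  obtain ⟨i₀, hi₀⟩ := Function.ne_iff.1 (orbitVec_ne_zero M c N)
  rw [← hw, Pi.zero_apply] at hi₀
  obtain ⟨i₁, i₂, h₁, h₂, h₁₂⟩ : ∃ i₁ i₂ : Fin (t + 1), i₁ ≠ i₀ ∧ i₂ ≠ i₀ ∧ i₁ ≠ i₂ := by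
    have hcard : 1 < (Finset.univ.erase i₀).card := by
      rw [Finset.card_erase_of_mem (Finset.mem_univ _), Finset.card_univ, Fintype.card_fin]
      omega
    obtain ⟨i₁, hi₁, i₂, hi₂, h⟩ := Finset.one_lt_card.1 hcard
    exact ⟨i₁, i₂, Finset.ne_of_mem_erase hi₁, Finset.ne_of_mem_erase hi₂, h⟩
  let l : Fin (t + 1) → MvPolynomial (Fin (t + 1)) k := fun i => C (w i₀) * X i - C (w i) * X i₀
  have hl : ∀ i, l i ∈ linearFormsAt w := fun i => mem_linearFormsAt.2
    ⟨((isHomogeneous_X k i).C_mul _).sub ((isHomogeneous_X k i₀).C_mul _), by simp [l, mul_comm]⟩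
  have hd : ∀ i j, j ≠ i₀ → pderiv j (l i) = if i = j then C (w i₀) else 0 := by
    intro i j hj
    simp only [l, map_sub, pderiv_C_mul, pderiv_X_of_ne hj.symm, mul_zero, sub_zero]
    split_ifs with h
    · rw [h, pderiv_X_self, mul_one]
    · rw [pderiv_X_of_ne h, mul_zero]
  have hlF : ∀ i, F * l i ∈ partR M c (N + 1) := fun i => by
    rw [partR, Finset.prod_range_succ]
    exact Submodule.mul_mem_mul hF (hl i)
  have hl0 : l i₁ ≠ 0 := by
    intro h
    have := hd i₁ i₁ h₁
    rw [h, map_zero, if_pos rfl, eq_comm, C_eq_zero] at this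
    exact hi₀ this
  obtain ⟨α, β, hαβ, hnot⟩ := hgcd (l i₁) (l i₂) hl0
  let ρ : Fin (t + 1) → algebraR M c := fun i =>
    ⟨ZhangTwist.ofPoly M (F * l i), ofPoly_mem_algebraR (hlF i)⟩
  have hρ : ∀ i n, twistComponent M n (ρ i : ZhangTwist M) = if n = N + 1 then F * l i else 0 :=
    fun i n => homogeneousComponent_of_mem ((mem_partR hc).1 (hlF i)).1
  refine ⟨ρ i₁ ⊗ₜ α - ρ i₂ ⊗ₜ β, ?_, fun m hm i => mem_tangencyIdeal.2 ⟨fun n _ => ?_, ?_⟩⟩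
  · -- The derivative along `x_j` of the witness is a unit multiple of `α` or of `β`.
    have hD : ∀ i j (b : B), j ≠ i₀ → derivFunctional M c B w j (N + 1) (ρ i ⊗ₜ b) =
        if i = j then algebraMap k B (eval w F * w i₀) * b else 0 := by
      intro i j b hj
      rw [derivFunctional_tmul, hρ, if_pos rfl, pderiv_mul, hd i j hj, map_add, map_mul, map_mul,
        (mem_linearFormsAt.1 (hl i)).2, mul_zero, zero_add]
      split_ifs <;> simp
    have hunit : ∀ b : B, algebraMap k B (eval w F * w i₀) * b ∈ 𝔭 N → b ∈ 𝔭 N := by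
      intro b hb
      have hu : IsUnit (algebraMap k B (eval w F * w i₀)) :=
        (IsUnit.mk0 _ (mul_ne_zero hF0 hi₀)).map (algebraMap k B)
      exact (Ideal.unit_mul_mem_iff_mem _ hu).1 hb
    rcases hnot N with h | h
    · refine ⟨i₁, fun hmem => h (hunit α ?_)⟩
      have := (mem_tangencyIdeal.1 hmem).2
      rwa [map_sub, hD _ _ _ h₁, hD _ _ _ h₁, if_pos rfl, if_neg h₁₂.symm, sub_zero] at this
    · refine ⟨i₂, fun hmem => h (hunit β ?_)⟩
      have := (mem_tangencyIdeal.1 hmem).2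
      rwa [map_sub, hD _ _ _ h₂, hD _ _ _ h₂, if_pos rfl, if_neg h₁₂, zero_sub,
        neg_mem_iff] at this
  · have := h𝔭 m
    refine pointFunctional_mem (orbitVec_ne_zero M c m) (hy m) (y := y) ?_
    rw [map_sub, componentFunctional_tmul, componentFunctional_tmul, hρ, hρ]
    split_ifs
    · change y (F * l i₁) * α - y (F * l i₂) * β = 0
      rw [map_mul, map_mul]
      linear_combination y F * hαβ
    · simp
  · rw [map_sub, derivFunctional_tmul, derivFunctional_tmul, hρ, hρ, if_neg (by omega), if_neg (by omega)]
    simp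

/-- Over the base ring of `exists_noetherian_base`, the left ideals generated by the first `N`
witnesses form a strictly increasing chain. -/
theorem not_isStronglyNoetherian_algebraR [Infinite k] (ht : 2 ≤ t)
    (hc : IsCriticallyDense (Set.range fun i : ℤ => M ^ (-i) • c)) :
    ¬ IsStronglyNoetherian k (algebraR M c) := by
  intro hstrong
  obtain ⟨B, _, _, y, 𝔭, hB, h𝔭, hy, hgcd⟩ := (isGenericSequence_orbitVec hc
    (s := fun n : ℕ => (n : ℤ)) Nat.cast_injective).exists_noetherian_base
  have hnoeth := hstrong B hB
  choose ξ hξ hξm using exists_tangency_witness ht hc h𝔭 hy hgcd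
  obtain ⟨N, hN⟩ := monotone_stabilizes_iff_noetherian.2 hnoeth
    ⟨fun N => Ideal.span (ξ '' Set.Iio N),
      fun a b hab => Ideal.span_mono (Set.image_mono (Set.Iio_subset_Iio hab))⟩
  obtain ⟨i, hi⟩ := hξ N
  refine hi ?_
  have h1 : ξ N ∈ Ideal.span (ξ '' Set.Iio N) := by
    have h2 := hN (N + 1) (Nat.le_succ N)
    change Ideal.span (ξ '' Set.Iio N) = Ideal.span (ξ '' Set.Iio (N + 1)) at h2
    rw [h2]
    exact Ideal.subset_span ⟨N, Nat.lt_succ_self N, rfl⟩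
  refine (Ideal.span_le.2 ?_ : Ideal.span (ξ '' Set.Iio N) ≤ _) h1
  rintro _ ⟨m, hm, rfl⟩
  exact hξm m N hm i

end NotStronglyNoetherian

theorem theorem6 {k : Type u} [Field k] [IsAlgClosed k] (t : ℕ) (ht : 2 ≤ t)
    (M : GL (Fin (t + 1)) k) (c : ℙ k (Fin (t + 1) → k))
    (hc : IsCriticallyDense (Set.range fun i : ℤ => M ^ (-i) • c)) :
    IsConnectedGraded (gradingR M c) ∧
      IsFinitelyGeneratedInDegreeOne (gradingR M c) ∧
      IsTwoSidedNoetherian (algebraR M c) ∧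
      ¬ IsStronglyNoetherian k (algebraR M c) := by
  have : Infinite k := IsAlgClosed.instInfinite
  exact ⟨isConnectedGraded_gradingR hc, isFinitelyGeneratedInDegreeOne_gradingR M c,
    ⟨isNoetherianRing_algebraR hc, isNoetherianRing_algebraR_op hc⟩,
    not_isStronglyNoetherian_algebraR ht hc⟩
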